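/- Let $V$ be a grading-restricted vertex algebra over $\mathbb C$ (no conformal vector is assumed), with vacuum $\mathbf 1$. A lower-bounded generalized $V$-module is a $V$-module $W$ (satisfying the Jacobi identity) with operators $L_W(0)$, $L_W(-1)$ satisfying $[L_W(0),L_W(-1)]=L_W(-1)$, the $L(0)$-commutator formula, and the $L(-1)$-derivative and $L(-1)$-commutator formulas, such that $W=\coprod_{a\in\mathbb C}W_{[a]}$ with $W_{[a]}$ the generalized $L_W(0)$-eigenspace of eigenvalue $a$, and $W_{[a]}=0$ when $\Re(a)$ is sufficiently negative. Let $\Gamma(W)\subset\mathbb C/\mathbb Z$ be the set of congruence classes of weights of $W$; for $\mu\in\Gamma(W)$ let $h^\mu\in\mu$ be the lowest weight of $W$ in $\mu$, and let $W_{\langle n\rangle}=\coprod_{\mu\in\Gamma(W)}W_{[h^\mu+n]}$, so that $W=\coprod_{n\in\mathbb N}W_{\langle n\rangle}$. Let $U^\infty(W)$ be the space of matrices $[w_{kl}]_{k,l\in\mathbb N}$ with entries in $W$ and with only finitely many nonzero entries in each column, and let $[w]_{kl}$ be the matrix whose only possibly nonzero entry is $w$, in position $(k,l)$; $U^\infty(V)$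 is defined in the same way. The maps below are given on the matrices $[\cdot]_{kl}$ and extended to all column-finite matrices in the obvious way: the $(k,l)$-entry of a product is the finite sum over $n\in\mathbb N$ of the products of $(k,n)$- with $(n,l)$-entries. For $v\in V$, $w\in W$ put $[v]_{km}\diamond[w]_{nl}=0=[w]_{km}\diamond[v]_{nl}$ if $m\neq n$, and $$[v]_{kn}\diamond[w]_{nl}=\sum_{m=0}^{n}\binom{-k+n-l-1}{m}\mathrm{Res}_x\,x^{-k+n-l-m-1}(1+x)^l\bigl[Y_W((1+x)^{L_V(0)}v,x)w\bigr]_{kl},$$ $$[w]_{kn}\diamond[v]_{nl}=\sum_{m=0}^{n}\binom{-k+n-l-1}{m}\mathrm{Res}_x\,x^{-k+n-l-m-1}(1+x)^k\bigl[Y_W((1+x)^{-L_V(0)}v,-x(1+x)^{-1})w\bigr]_{kl},$$ where powers of $1+x$ are expanded in nonnegative powers of $x$. The product $\diamond$ on $U^\infty(V)$ is given by the first formula with $W=V$. Let $\mathbf 1^\infty\in U^\infty(V)$ be the diagonal matrix with all diagonal entries $\mathbf 1$. Define $\vartheta_W:U^\infty(V)\to\mathrm{End}\,W$ by $\vartheta_W([v]_{kl})w=\delta_{ln}\mathrm{Res}_x\,x^{l-k-1}Y_W(x^{L_V(0)}v,x)w$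 for $w\in W_{\langle n\rangle}$. Let $Q^\infty(V)$ be the intersection of $\ker\vartheta_W$ over all lower-bounded generalized $V$-modules $W$, and $A^\infty(V)=U^\infty(V)/Q^\infty(V)$. For lower-bounded generalized $V$-modules $W,W_2,W_3$, an intertwining operator of type $\binom{W_3}{W\,W_2}$ is a logarithmic intertwining operator $$\mathcal Y(w,x)w_2=\sum_{n\in\mathbb C}\sum_{k\in\mathbb N}\mathcal Y_{n,k}(w)w_2\,x^{-n-1}(\log x)^k\in W_3[\log x]\{x\},$$ satisfying lower truncation, the Jacobi identity, the $L(-1)$-derivative property, and the $L(0)$- and $L(-1)$-commutator formulas, and such that for all $w,w_2$ the powers of $x$ in $\mathcal Y(w,x)w_2$ belong to only finitely many classes in $\mathbb C/\mathbb Z$. Let $\mathcal Y^0(w,x)=\sum_n\mathcal Y_{n,0}(w)x^{-n-1}$, and let $x^{L_W(0)_S}$ act on $W_{[a]}$ as $x^a$. Write $h_2^\mu,h_3^\nu$ for the numbers $h^\mu$, $h^\nu$ of $W_2$, $W_3$. Define $\vartheta_{\mathcal Y}:U^\infty(W)\to\mathrm{Hom}(W_2,W_3)$ by $$\vartheta_{\mathcal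 Y}([w]_{kl})w_2=\delta_{lp}\sum_{\nu\in\Gamma(W_3)}\mathrm{Res}_x\,x^{h_2^\mu-h_3^\nu+l-k-1}\,\mathcal Y^0(x^{L_W(0)_S}w,x)w_2\qquad\text{for }\mu\in\Gamma(W_2),\ p\in\mathbb N,\ w_2\in(W_2)_{[h_2^\mu+p]}.$$ Let $W$ be a lower-bounded generalized $V$-module. Then: 1. For all lower-bounded generalized $V$-modules $W_2,W_3$, every intertwining operator $\mathcal Y$ of type $\binom{W_3}{W\,W_2}$, and all $\mathfrak v\in U^\infty(V)$, $\mathfrak w\in U^\infty(W)$, $$\vartheta_{\mathcal Y}(\mathfrak v\diamond\mathfrak w)=\vartheta_{W_3}(\mathfrak v)\,\vartheta_{\mathcal Y}(\mathfrak w),\qquad \vartheta_{\mathcal Y}(\mathfrak w\diamond\mathfrak v)=\vartheta_{\mathcal Y}(\mathfrak w)\,\vartheta_{W_2}(\mathfrak v).$$ 2. The product $\diamond$ on $U^\infty(V)$ induces a product on $A^\infty(V)$, which makes it an associative algebra with identity $\mathbf 1^\infty+Q^\infty(V)$. For every $\mathcal Y$ as in 1, the left and right $\diamond$-actions of $U^\infty(V)$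 on $U^\infty(W)$ induce well-defined actions of $A^\infty(V)$ on $U^\infty(W)/\ker\vartheta_{\mathcal Y}$, and these make it an $A^\infty(V)$-bimodule. 3. Let $Q^\infty(W)$ be the intersection of $\ker\vartheta_{\mathcal Y}$ over all lower-bounded generalized $V$-modules $W_2,W_3$ and all intertwining operators $\mathcal Y$ of type $\binom{W_3}{W\,W_2}$. Then the $\diamond$-actions induce well-defined actions of $A^\infty(V)$ on $A^\infty(W)=U^\infty(W)/Q^\infty(W)$, and these make it an $A^\infty(V)$-bimodule. -/

import Mathlib

universe u v w

noncomputable section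

/-! ### Linear maps out of internally graded spaces -/

/-- The linear map out of `M = ⨁ i, 𝒜 i` that is given by `f i` on the summand `𝒜 i`. -/
def gradedLift {ι M N : Type*} [DecidableEq ι] [AddCommGroup M] [Module ℂ M] [AddCommGroup N]
    [Module ℂ N] (𝒜 : ι → Submodule ℂ M) (h : DirectSum.IsInternal 𝒜) (f : ι → M →ₗ[ℂ] N) :
    M →ₗ[ℂ] N :=
  DirectSum.toModule ℂ ι N (fun i => f i ∘ₗ (𝒜 i).subtype) ∘ₗ
    (LinearEquiv.ofBijective (DirectSum.coeLinearMap 𝒜) h).symm.toLinearMap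

theorem gradedLift_of_mem {ι M N : Type*} [DecidableEq ι] [AddCommGroup M] [Module ℂ M]
    [AddCommGroup N] [Module ℂ N] (𝒜 : ι → Submodule ℂ M) (h : DirectSum.IsInternal 𝒜)
    (f : ι → M →ₗ[ℂ] N) {i : ι} {x : M} (hx : x ∈ 𝒜 i) : gradedLift 𝒜 h f x = f i x := by
  have : (LinearEquiv.ofBijective (DirectSum.coeLinearMap 𝒜) h).symm x
      = DirectSum.lof ℂ ι (fun i => 𝒜 i) i ⟨x, hx⟩ := by
    rw [LinearEquiv.symm_apply_eq]
    exact (DirectSum.coeLinearMap_lof 𝒜 i ⟨x, hx⟩).symm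
  simp only [gradedLift, LinearMap.comp_apply, LinearEquiv.coe_coe, this, DirectSum.toModule_lof]
  rfl

/-! ### Vertex algebras and their modules -/

/-- The mode `v_n w` of a vertex operator map `Y(v, x) w = ∑ n, v_n w x ^ (-n - 1)`.  The type
`VertexOperator ℂ W` consists of linear maps from `W` to Laurent series `W((x))`, so the
lower truncation condition is built in. -/
def mode {V W : Type*} [AddCommGroup V] [Module ℂ V] [AddCommGroup W] [Module ℂ W]
    (Y : V →ₗ[ℂ] VertexOperator ℂ W) (n : ℤ) : V →ₗ[ℂ] W →ₗ[ℂ] W :=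
  LinearMap.proj n ∘ₗ VertexOperator.ncoeff ∘ₗ Y

/-- The Jacobi identity in terms of modes: this is the coefficient form of
`x₀⁻¹ δ((x₁ - x₂)/x₀) Y₃(v, x₁) 𝒴(w, x₂) w₂ - x₀⁻¹ δ((x₂ - x₁)/(-x₀)) 𝒴(w, x₂) Y₂(v, x₁) w₂
  = x₂⁻¹ δ((x₁ - x₀)/x₂) 𝒴(Y₁(v, x₀) w, x₂) w₂`.
The index ring `I` of the modes of `𝒴` is `ℤ` or `ℂ`, and all sums are finite for maps
that satisfy lower truncation. -/
def JacobiIdentity {I V W W₂ W₃ : Type*} [Ring I] [AddCommGroup W₃] [Module ℂ W₃]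
    (Y₁ : ℤ → V → W → W) (Y₂ : ℤ → V → W₂ → W₂) (Y₃ : ℤ → V → W₃ → W₃)
    (𝒴 : I → W → W₂ → W₃) : Prop :=
  ∀ (l m : ℤ) (n : I) (v : V) (w : W) (w₂ : W₂),
    ∑ᶠ i : ℕ, ((Ring.choose m i : ℤ) : ℂ) • 𝒴 (m + n - i) (Y₁ (l + i) v w) w₂ =
      ∑ᶠ i : ℕ, ((-1 : ℂ) ^ i * ((Ring.choose l i : ℤ) : ℂ)) •
          Y₃ (m + l - i) v (𝒴 (n + i) w w₂)
        - ∑ᶠ i : ℕ, ((-1 : ℂ) ^ (l + i) * ((Ring.choose l i : ℤ) : ℂ)) •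
          𝒴 (n + l - i) w (Y₂ (m + i) v w₂)

/-- A grading-restricted vertex algebra (no conformal vector is assumed).  The space
`V_(n)` is the eigenspace of `L(0)` with eigenvalue `n`. -/
class GradingRestrictedVertexAlgebra (V : Type u) [AddCommGroup V] [Module ℂ V] where
  /-- the vertex operator map -/
  Y : V →ₗ[ℂ] VertexOperator ℂ V
  /-- the vacuum -/
  vac : V
  /-- the grading operator `L_V(0)` -/
  L0 : Module.End ℂ V
  /-- the operator `L_V(-1)` -/
  Lneg : Module.End ℂ V
  isInternal : DirectSum.IsInternal fun n : ℤ => L0.eigenspace (n : ℂ)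
  finite_dim : ∀ n : ℤ, FiniteDimensional ℂ (L0.eigenspace (n : ℂ))
  bounded_below : ∃ N : ℤ, ∀ n < N, L0.eigenspace (n : ℂ) = ⊥
  L0_commutator : ∀ (u : V) (n : ℤ) (v : V),
    L0 (mode Y n u v) - mode Y n u (L0 v) = mode Y n (L0 u) v + (-(n : ℂ) - 1) • mode Y n u v
  vac_weight : L0 vac = 0
  identity : ∀ (n : ℤ) (v : V), mode Y n vac v = if n = -1 then v else 0
  creation : ∀ (n : ℤ) (v : V), -1 ≤ n → mode Y n v vac = if n = -1 then v else 0
  Lneg_derivative : ∀ (u : V) (n : ℤ) (v : V),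
    mode Y n (Lneg u) v = -(n : ℂ) • mode Y (n - 1) u v
  Lneg_commutator : ∀ (u : V) (n : ℤ) (v : V),
    Lneg (mode Y n u v) - mode Y n u (Lneg v) = mode Y n (Lneg u) v
  jacobi : JacobiIdentity (I := ℤ) (fun n u v => mode Y n u v) (fun n u v => mode Y n u v)
    (fun n u v => mode Y n u v) (fun n u v => mode Y n u v)

/-- A lower-bounded generalized module for a grading-restricted vertex algebra.  The space
`W_[a]` is the generalized eigenspace of `L_W(0)` with eigenvalue `a`. -/
class LowerBoundedGeneralizedModule (V : Type u) [AddCommGroup V] [Module ℂ V]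
    [GradingRestrictedVertexAlgebra V] (W : Type v) [AddCommGroup W] [Module ℂ W] where
  /-- the vertex operator map -/
  Y : V →ₗ[ℂ] VertexOperator ℂ W
  /-- the operator `L_W(0)` -/
  L0 : Module.End ℂ W
  /-- the operator `L_W(-1)` -/
  Lneg : Module.End ℂ W
  isInternal : DirectSum.IsInternal fun a : ℂ => L0.maxGenEigenspace a
  lower_bounded : ∃ B : ℝ, ∀ a : ℂ, a.re < B → L0.maxGenEigenspace a = ⊥
  L0_commutator : ∀ (v : V) (n : ℤ) (w : W),
    L0 (mode Y n v w) - mode Y n v (L0 w) =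
      mode Y n (GradingRestrictedVertexAlgebra.L0 v) w + (-(n : ℂ) - 1) • mode Y n v w
  identity : ∀ (n : ℤ) (w : W),
    mode Y n (GradingRestrictedVertexAlgebra.vac : V) w = if n = -1 then w else 0
  Lneg_derivative : ∀ (v : V) (n : ℤ) (w : W),
    mode Y n (GradingRestrictedVertexAlgebra.Lneg v) w = -(n : ℂ) • mode Y (n - 1) v w
  Lneg_commutator : ∀ (v : V) (n : ℤ) (w : W),
    Lneg (mode Y n v w) - mode Y n v (Lneg w) =
      mode Y n (GradingRestrictedVertexAlgebra.Lneg v) w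
  L0_Lneg : ∀ w : W, L0 (Lneg w) - Lneg (L0 w) = Lneg w
  jacobi : JacobiIdentity (I := ℤ)
    (fun n u v => mode (GradingRestrictedVertexAlgebra.Y (V := V)) n u v)
    (fun n v w => mode Y n v w) (fun n v w => mode Y n v w) (fun n v w => mode Y n v w)

/-- The group `ℂ/ℤ`. -/
abbrev CModZ : Type := ℂ ⧸ AddSubgroup.zmultiples (1 : ℂ)

/-- The congruence class modulo `ℤ` of a complex number. -/
def toCModZ (a : ℂ) : CModZ := QuotientAddGroup.mk a

theorem toCModZ_eq_iff {a b : ℂ} : toCModZ a = toCModZ b ↔ ∃ n : ℤ, b = a + n := by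
  unfold toCModZ
  rw [QuotientAddGroup.eq, AddSubgroup.mem_zmultiples_iff]
  constructor
  · rintro ⟨n, hn⟩
    refine ⟨n, ?_⟩
    rw [zsmul_one] at hn
    rw [hn]; ring
  · rintro ⟨n, hn⟩
    refine ⟨n, ?_⟩
    rw [zsmul_one, hn]; ring

section Modules

variable (V : Type u) [AddCommGroup V] [Module ℂ V] [GradingRestrictedVertexAlgebra V]
variable (W : Type v) [AddCommGroup W] [Module ℂ W] [LowerBoundedGeneralizedModule V W]

/-- The homogeneous subspace `V_(n)`. -/
def homSpace (n : ℤ) : Submodule ℂ V :=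
  (GradingRestrictedVertexAlgebra.L0 (V := V)).eigenspace (n : ℂ)

/-- The subspace `W_[a]` of elements of weight `a`. -/
def wtSpace (a : ℂ) : Submodule ℂ W :=
  (LowerBoundedGeneralizedModule.L0 V (W := W)).maxGenEigenspace a

theorem homSpace_isInternal : DirectSum.IsInternal (homSpace V) :=
  GradingRestrictedVertexAlgebra.isInternal

theorem wtSpace_isInternal : DirectSum.IsInternal (wtSpace V W) :=
  LowerBoundedGeneralizedModule.isInternal

/-- The mode `v_n w` for `v ∈ V`, `w ∈ W`. -/
def actionMode (n : ℤ) : V →ₗ[ℂ] W →ₗ[ℂ] W :=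
  mode (LowerBoundedGeneralizedModule.Y (V := V) (W := W)) n

/-- The set `Γ(W)` of congruence classes of weights of `W`. -/
def weightClasses : Set CModZ := {μ | ∃ a : ℂ, toCModZ a = μ ∧ wtSpace V W a ≠ ⊥}

/-- `a` is the lowest weight of `W` in the class `μ`. -/
def IsLowestWeight (μ : CModZ) (a : ℂ) : Prop :=
  toCModZ a = μ ∧ wtSpace V W a ≠ ⊥ ∧ ∀ n : ℕ, 0 < n → wtSpace V W (a - n) = ⊥

theorem exists_isLowestWeight {μ : CModZ} (hμ : μ ∈ weightClasses V W) :
    ∃ a, IsLowestWeight V W μ a := by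
  classical
  obtain ⟨a, rfl, ha⟩ := hμ
  obtain ⟨B, hB⟩ := LowerBoundedGeneralizedModule.lower_bounded (V := V) (W := W)
  obtain ⟨K, hK⟩ := exists_nat_gt (a.re - B)
  have hbd : ∀ n : ℕ, K ≤ n → wtSpace V W (a - n) = ⊥ := by
    intro n hn
    apply hB
    have : (K : ℝ) ≤ n := by exact_mod_cast hn
    simp
    linarith
  have hex : ∃ m : ℕ, ∀ n : ℕ, m < n → wtSpace V W (a - n) = ⊥ :=
    ⟨K, fun n hn => hbd n hn.le⟩
  have hspec := Nat.find_spec hex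
  refine ⟨a - (Nat.find hex : ℕ), toCModZ_eq_iff.2 ⟨Nat.find hex, by push_cast; ring⟩, ?_, ?_⟩
  · intro h0
    rcases Nat.eq_zero_or_pos (Nat.find hex) with h | h
    · rw [h] at h0
      simp at h0
      exact ha h0
    · refine Nat.find_min hex (Nat.sub_lt h Nat.one_pos) ?_
      intro n hn
      rcases Nat.lt_or_ge (Nat.find hex) n with h' | h'
      · exact hspec n h'
      · have : n = Nat.find hex := by omega
        rw [this]; exact h0
  · intro n hn
    have := hspec (Nat.find hex + n) (by omega)
    have e : a - ((Nat.find hex : ℕ) : ℂ) - n = a - ((Nat.find hex + n : ℕ) : ℂ) := by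
      push_cast; ring
    rw [e]; exact this

open Classical in
/-- The lowest weight `h^μ` of `W` in the class `μ ∈ Γ(W)` (and `0` for the other classes). -/
def lowestWeight (μ : CModZ) : ℂ :=
  if h : ∃ a, IsLowestWeight V W μ a then h.choose else 0

theorem isLowestWeight_lowestWeight {μ : CModZ} (hμ : μ ∈ weightClasses V W) :
    IsLowestWeight V W μ (lowestWeight V W μ) := by
  have h := exists_isLowestWeight V W hμ
  rw [lowestWeight, dif_pos h]
  exact h.choose_spec

/-- The level of the weight `a`, that is, the `n ∈ ℕ` with `a = h^μ + n` for the class `μ` of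
`a`; this is used only for weights `a` with `W_[a] ≠ 0`. -/
def level (a : ℂ) : ℕ := ⌊(a - lowestWeight V W (toCModZ a)).re⌋₊

theorem eq_lowestWeight_add_level {a : ℂ} (ha : wtSpace V W a ≠ ⊥) :
    a = lowestWeight V W (toCModZ a) + level V W a := by
  obtain ⟨h1, -, h3⟩ :=
    isLowestWeight_lowestWeight V W (μ := toCModZ a) ⟨a, rfl, ha⟩
  obtain ⟨n, hn⟩ := toCModZ_eq_iff.1 h1
  have hn0 : 0 ≤ n := by
    by_contra hlt
    push Not at hlt
    obtain ⟨k, hk⟩ := Int.eq_ofNat_of_zero_le (a := -n) (by omega)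
    have h := h3 k (by omega)
    apply ha
    rw [hn, ← h]
    congr 1
    have : (n : ℂ) = -(k : ℂ) := by
      have : n = -(k : ℤ) := by omega
      rw [this]; push_cast; ring
    rw [this]; ring
  obtain ⟨k, rfl⟩ := Int.eq_ofNat_of_zero_le hn0
  have : level V W a = k := by
    unfold level
    have : a - lowestWeight V W (toCModZ a) = (k : ℂ) :=
      sub_eq_iff_eq_add'.2 (by exact_mod_cast hn)
    rw [this]
    simp
  rw [this]
  exact_mod_cast hn

/-- The decomposition of an element of `W` according to the canonical `ℕ`-grading
`W = ⨁ n, W_⟨n⟩`, where `W_⟨n⟩ = ⨁ μ ∈ Γ(W), W_[h^μ + n]`. -/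
def levelComponents : W →ₗ[ℂ] ℕ →₀ W :=
  gradedLift (wtSpace V W) (wtSpace_isInternal V W)
    fun a => Finsupp.lsingle (level V W a)

theorem levelComponents_of_mem {μ : CModZ} (hμ : μ ∈ weightClasses V W) (n : ℕ) {x : W}
    (hx : x ∈ wtSpace V W (lowestWeight V W μ + n)) :
    levelComponents V W x = Finsupp.single n x := by
  rw [levelComponents, gradedLift_of_mem _ _ _ hx]
  have h1 := (isLowestWeight_lowestWeight V W hμ).1
  have h2 : toCModZ (lowestWeight V W μ + n) = μ := by
    conv_rhs => rw [← h1]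
    exact (toCModZ_eq_iff.2 ⟨n, by push_cast; rfl⟩).symm
  have : level V W (lowestWeight V W μ + n) = n := by
    unfold level
    rw [h2]
    simp
  rw [this]
  rfl

end Modules

/-! ### Column-finite matrices -/

/-- The space `U^∞(W)` of column-finite `ℕ × ℕ` matrices with entries in `W`: such a matrix is
the family, indexed by `l`, of its finitely supported columns, so that the entry in row `k` and
column `l` of `M` is `M l k`. -/
abbrev UInf (W : Type*) [AddCommGroup W] : Type _ := ℕ → ℕ →₀ W

/-- The linear extension to column-finite matrices of the assignment which sends the matrix
`[w]_{kl}` to the operator that is `θ k l w` on level `l` and `0` on all other levels. -/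
def matrixOperator (V : Type u) [AddCommGroup V] [Module ℂ V]
    [GradingRestrictedVertexAlgebra V] {W : Type*} [AddCommGroup W] [Module ℂ W]
    {W₂ : Type*} [AddCommGroup W₂] [Module ℂ W₂] [LowerBoundedGeneralizedModule V W₂]
    {W₃ : Type*} [AddCommGroup W₃] [Module ℂ W₃]
    (θ : ℕ → ℕ → W →ₗ[ℂ] W₂ →ₗ[ℂ] W₃) : UInf W →ₗ[ℂ] W₂ →ₗ[ℂ] W₃ :=
  LinearMap.mk₂ ℂ
    (fun M w₂ => (levelComponents V W₂ w₂).sum fun l x => (M l).sum fun k w => θ k l w x)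
    (by
      intro M M' w₂
      rw [← Finsupp.sum_add]
      refine Finsupp.sum_congr fun l _ => ?_
      exact Finsupp.sum_add_index' (by simp) (by simp))
    (by
      intro c M w₂
      rw [Finsupp.smul_sum]
      refine Finsupp.sum_congr fun l _ => ?_
      rw [Pi.smul_apply, Finsupp.sum_smul_index' (by simp), Finsupp.smul_sum]
      simp)
    (by
      intro M x y
      rw [map_add]
      exact Finsupp.sum_add_index' (by simp) (by simp))
    (by
      intro c M x
      rw [map_smul, Finsupp.sum_smul_index' (by simp), Finsupp.smul_sum]
      refine Finsupp.sum_congr fun l _ => ?_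
      rw [Finsupp.smul_sum]
      simp)

/-! ### The left and right actions of `U^∞(V)` on `U^∞(W)` -/

section Actions

variable {V : Type u} [AddCommGroup V] [Module ℂ V]
variable {W : Type v} [AddCommGroup W] [Module ℂ W]

theorem finite_support_mode (Y : V →ₗ[ℂ] VertexOperator ℂ W) (c : ℕ → ℂ) (s : ℤ) (x : V) (y : W) :
    (Function.support fun i : ℕ => c i • mode Y (s + i) x y).Finite := by
  refine (Set.finite_lt_nat
    (-s - ((HahnModule.of ℂ).symm (Y x y)).order).toNat).subset fun i hi => ?_
  by_contra hni
  apply hi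
  have : mode Y (s + i) x y = 0 := by
    apply VertexOperator.ncoeff_eq_zero_of_lt_order
    simp only [Set.mem_ofPred_eq, not_lt] at hni
    omega
  simp only [this, smul_zero]

/-- The bilinear map `(v, w) ↦ ∑ i ≥ 0, c i • v_{s + i} w`, a finite sum for all `v`, `w`. -/
def modeSum (Y : V →ₗ[ℂ] VertexOperator ℂ W) (c : ℕ → ℂ) (s : ℤ) : V →ₗ[ℂ] W →ₗ[ℂ] W :=
  LinearMap.mk₂ ℂ (fun x y => ∑ᶠ i : ℕ, c i • mode Y (s + i) x y)
    (by
      intro x x' y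
      rw [← finsum_add_distrib (finite_support_mode Y c s x y)
        (finite_support_mode Y c s x' y)]
      simp)
    (by
      intro r x y
      rw [smul_finsum]
      exact finsum_congr fun i => by
        rw [map_smul, LinearMap.smul_apply]; exact smul_comm _ _ _)
    (by
      intro x y y'
      rw [← finsum_add_distrib (finite_support_mode Y c s x y)
        (finite_support_mode Y c s x y')]
      simp)
    (by
      intro r x y
      rw [smul_finsum]
      exact finsum_congr fun i => by rw [map_smul]; exact smul_comm _ _ _)

variable (V)
variable [GradingRestrictedVertexAlgebra V]

/-- The entry of `[v]_{kn} ⋄ [w]_{nl}` in row `k` and column `l`, which is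
`∑ m ≤ n, binom(-k+n-l-1, m) Res_x x ^ (-k+n-l-m-1) (1+x) ^ l Y((1+x) ^ L(0) v, x) w`.
For `v` of weight `d`, the residue is that of `x ^ s (1+x) ^ (l+d) Y(v, x) w` with
`s = -k+n-l-m-1`, and it is equal to `∑ i ≥ 0, binom(l+d, i) v_{s+i} w`. -/
def leftEntry (Y : V →ₗ[ℂ] VertexOperator ℂ W) (k n l : ℕ) : V →ₗ[ℂ] W →ₗ[ℂ] W :=
  gradedLift (homSpace V) (homSpace_isInternal V) fun d =>
    ∑ m ∈ Finset.range (n + 1),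
      ((Ring.choose (-(k : ℤ) + n - l - 1) m : ℤ) : ℂ) •
        modeSum Y (fun i => ((Ring.choose ((l : ℤ) + d) i : ℤ) : ℂ)) (-(k : ℤ) + n - l - m - 1)

/-- The entry of `[w]_{kn} ⋄ [v]_{nl}` in row `k` and column `l`, which is
`∑ m ≤ n, binom(-k+n-l-1, m) Res_x x ^ (-k+n-l-m-1) (1+x) ^ k
Y((1+x) ^ (-L(0)) v, -x (1+x)⁻¹) w`.
For `v` of weight `d`, the residue is that of `∑ p, (-1) ^ (p+1) x ^ (s-p-1) (1+x) ^ (k-d+p+1) v_p w`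
with `s = -k+n-l-m-1`; the term with `p = s+i`, `i ≥ 0`, contributes
`(-1) ^ (s+i+1) binom(k-d+s+i+1, i) v_{s+i} w`, and the terms with `p < s` contribute `0`. -/
def rightEntry (Y : V →ₗ[ℂ] VertexOperator ℂ W) (k n l : ℕ) : V →ₗ[ℂ] W →ₗ[ℂ] W :=
  gradedLift (homSpace V) (homSpace_isInternal V) fun d =>
    ∑ m ∈ Finset.range (n + 1),
      ((Ring.choose (-(k : ℤ) + n - l - 1) m : ℤ) : ℂ) •
        modeSum Y
          (fun i => (-1 : ℂ) ^ ((-(k : ℤ) + n - l - m - 1) + i + 1) *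
            ((Ring.choose ((k : ℤ) - d + (-(k : ℤ) + n - l - m - 1) + i + 1) i : ℤ) : ℂ))
          (-(k : ℤ) + n - l - m - 1)

/-- The product `𝔳 ⋄ 𝔴` for `𝔳 ∈ U^∞(V)`, `𝔴 ∈ U^∞(W)`: its entry in row `k` and column `l` is
`∑ n, leftEntry k n l (v_{kn}) (w_{nl})`. -/
def leftDiamond (Y : V →ₗ[ℂ] VertexOperator ℂ W) : UInf V →ₗ[ℂ] UInf W →ₗ[ℂ] UInf W :=
  LinearMap.mk₂ ℂ
    (fun 𝔳 𝔴 l => (𝔴 l).sum fun n y => (𝔳 n).sum fun k x =>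
      Finsupp.single k (leftEntry V Y k n l x y))
    (by
      intro 𝔳 𝔳' 𝔴
      funext l
      rw [Pi.add_apply, ← Finsupp.sum_add]
      refine Finsupp.sum_congr fun n _ => ?_
      exact Finsupp.sum_add_index' (by simp) (by simp))
    (by
      intro c 𝔳 𝔴
      funext l
      rw [Pi.smul_apply, Finsupp.smul_sum]
      refine Finsupp.sum_congr fun n _ => ?_
      rw [Pi.smul_apply, Finsupp.sum_smul_index' (by simp), Finsupp.smul_sum]
      simp)
    (by
      intro 𝔳 𝔴 𝔴'
      funext l
      exact Finsupp.sum_add_index' (by simp) (by simp))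
    (by
      intro c 𝔳 𝔴
      funext l
      rw [Pi.smul_apply, Pi.smul_apply, Finsupp.sum_smul_index' (by simp), Finsupp.smul_sum]
      refine Finsupp.sum_congr fun n _ => ?_
      rw [Finsupp.smul_sum]
      simp)

/-- The product `𝔴 ⋄ 𝔳` for `𝔴 ∈ U^∞(W)`, `𝔳 ∈ U^∞(V)`: its entry in row `k` and column `l` is
`∑ n, rightEntry k n l (v_{nl}) (w_{kn})`. -/
def rightDiamond (Y : V →ₗ[ℂ] VertexOperator ℂ W) : UInf W →ₗ[ℂ] UInf V →ₗ[ℂ] UInf W :=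
  LinearMap.mk₂ ℂ
    (fun 𝔴 𝔳 l => (𝔳 l).sum fun n x => (𝔴 n).sum fun k y =>
      Finsupp.single k (rightEntry V Y k n l x y))
    (by
      intro 𝔴 𝔴' 𝔳
      funext l
      rw [Pi.add_apply, ← Finsupp.sum_add]
      refine Finsupp.sum_congr fun n _ => ?_
      exact Finsupp.sum_add_index' (by simp) (by simp))
    (by
      intro c 𝔴 𝔳
      funext l
      rw [Pi.smul_apply, Finsupp.smul_sum]
      refine Finsupp.sum_congr fun n _ => ?_
      rw [Pi.smul_apply, Finsupp.sum_smul_index' (by simp), Finsupp.smul_sum]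
      simp)
    (by
      intro 𝔴 𝔳 𝔳'
      funext l
      exact Finsupp.sum_add_index' (by simp) (by simp))
    (by
      intro c 𝔴 𝔳
      funext l
      rw [Pi.smul_apply, Pi.smul_apply, Finsupp.sum_smul_index' (by simp), Finsupp.smul_sum]
      refine Finsupp.sum_congr fun n _ => ?_
      rw [Finsupp.smul_sum]
      simp)

end Actions

section Algebra

variable (V : Type u) [AddCommGroup V] [Module ℂ V] [GradingRestrictedVertexAlgebra V]

/-- The product `⋄` on `U^∞(V)`. -/
def algDiamond : UInf V →ₗ[ℂ] UInf V →ₗ[ℂ] UInf V :=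
  leftDiamond V (GradingRestrictedVertexAlgebra.Y (V := V))

/-- The diagonal matrix `1^∞` with all diagonal entries equal to the vacuum. -/
def oneInf : UInf V := fun l => Finsupp.single l GradingRestrictedVertexAlgebra.vac

variable (W : Type v) [AddCommGroup W] [Module ℂ W] [LowerBoundedGeneralizedModule V W]

/-- The left action of `U^∞(V)` on `U^∞(W)`. -/
def leftAct : UInf V →ₗ[ℂ] UInf W →ₗ[ℂ] UInf W :=
  leftDiamond V (LowerBoundedGeneralizedModule.Y (V := V) (W := W))

/-- The right action of `U^∞(V)` on `U^∞(W)`. -/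
def rightAct : UInf W →ₗ[ℂ] UInf V →ₗ[ℂ] UInf W :=
  rightDiamond V (LowerBoundedGeneralizedModule.Y (V := V) (W := W))

/-- The map `ϑ_W : U^∞(V) → End W`.  On level `l` the matrix `[v]_{kl}` acts as
`Res_x x ^ (l-k-1) Y_W(x ^ L(0) v, x)`, which is `v_{d+l-k-1}` for `v` of weight `d`. -/
def thetaModule : UInf V →ₗ[ℂ] W →ₗ[ℂ] W :=
  matrixOperator V fun k l =>
    gradedLift (homSpace V) (homSpace_isInternal V) fun d =>
      actionMode V W (d + l - k - 1)

/-- `Q^∞(V)`, the intersection of `ker ϑ_W` over all lower-bounded generalized modules `W`. -/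
def QInfAlg : Submodule ℂ (UInf V) :=
  ⨅ (W : Type w) (_ : AddCommGroup W) (_ : Module ℂ W) (_ : LowerBoundedGeneralizedModule V W),
    LinearMap.ker (thetaModule V W)

/-- `A^∞(V) = U^∞(V) / Q^∞(V)`. -/
abbrev AInfAlg : Type u := UInf V ⧸ QInfAlg.{u, w} V

end Algebra

/-! ### Intertwining operators -/

/-- A (logarithmic) intertwining operator of type `(W₃ over W W₂)` with locally-finite sets of
congruence classes of powers:
`𝒴(w, x) w₂ = ∑ (n : ℂ) (k : ℕ), coeff n k w w₂ x ^ (-n - 1) (log x) ^ k`. -/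
structure IntertwiningOperator (V : Type*) [AddCommGroup V] [Module ℂ V]
    [GradingRestrictedVertexAlgebra V]
    (W : Type*) [AddCommGroup W] [Module ℂ W] [LowerBoundedGeneralizedModule V W]
    (W₂ : Type*) [AddCommGroup W₂] [Module ℂ W₂] [LowerBoundedGeneralizedModule V W₂]
    (W₃ : Type*) [AddCommGroup W₃] [Module ℂ W₃] [LowerBoundedGeneralizedModule V W₃] where
  /-- the coefficient of `x ^ (-n - 1) (log x) ^ k` -/
  coeff : ℂ → ℕ → W →ₗ[ℂ] W₂ →ₗ[ℂ] W₃
  /-- each power of `x` is multiplied by a polynomial in `log x` -/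
  log_finite : ∀ (w : W) (w₂ : W₂) (n : ℂ), ∃ K : ℕ, ∀ k ≥ K, coeff n k w w₂ = 0
  /-- lower truncation -/
  truncation : ∀ (w : W) (w₂ : W₂) (n : ℂ), ∃ M : ℕ, ∀ m ≥ M, ∀ k, coeff (n + (m : ℕ)) k w w₂ = 0
  /-- for all `w`, `w₂`, the powers of `x` lie in finitely many congruence classes modulo `ℤ` -/
  finite_classes : ∀ (w : W) (w₂ : W₂),
    {μ : CModZ | ∃ (n : ℂ) (k : ℕ), coeff n k w w₂ ≠ 0 ∧ toCModZ (-n - 1) = μ}.Finite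
  jacobi : ∀ k : ℕ, JacobiIdentity (I := ℂ) (fun n v w => actionMode V W n v w)
    (fun n v w => actionMode V W₂ n v w) (fun n v w => actionMode V W₃ n v w)
    (fun n w w₂ => coeff n k w w₂)
  /-- `d/dx 𝒴(w, x) = 𝒴(L(-1) w, x)` -/
  Lneg_derivative : ∀ (n : ℂ) (k : ℕ) (w : W) (w₂ : W₂),
    coeff n k (LowerBoundedGeneralizedModule.Lneg V w) w₂ =
      -n • coeff (n - 1) k w w₂ + ((k : ℂ) + 1) • coeff (n - 1) (k + 1) w w₂
  /-- `[L(0), 𝒴(w, x)] = 𝒴(L(0) w, x) + x 𝒴(L(-1) w, x)` -/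
  L0_commutator : ∀ (n : ℂ) (k : ℕ) (w : W) (w₂ : W₂),
    LowerBoundedGeneralizedModule.L0 V (coeff n k w w₂)
        - coeff n k w (LowerBoundedGeneralizedModule.L0 V w₂) =
      coeff n k (LowerBoundedGeneralizedModule.L0 V w) w₂
        + coeff (n + 1) k (LowerBoundedGeneralizedModule.Lneg V w) w₂
  /-- `[L(-1), 𝒴(w, x)] = 𝒴(L(-1) w, x)` -/
  Lneg_commutator : ∀ (n : ℂ) (k : ℕ) (w : W) (w₂ : W₂),
    LowerBoundedGeneralizedModule.Lneg V (coeff n k w w₂)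
        - coeff n k w (LowerBoundedGeneralizedModule.Lneg V w₂) =
      coeff n k (LowerBoundedGeneralizedModule.Lneg V w) w₂

section Intertwining

variable {V : Type*} [AddCommGroup V] [Module ℂ V] [GradingRestrictedVertexAlgebra V]
variable {W : Type*} [AddCommGroup W] [Module ℂ W] [LowerBoundedGeneralizedModule V W]
variable {W₂ : Type*} [AddCommGroup W₂] [Module ℂ W₂] [LowerBoundedGeneralizedModule V W₂]
variable {W₃ : Type*} [AddCommGroup W₃] [Module ℂ W₃] [LowerBoundedGeneralizedModule V W₃]

theorem finite_support_classSum (𝒴 : IntertwiningOperator V W W₂ W₃) (c : ℂ) (w : W) (w₂ : W₂) :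
    (Function.support fun ν : weightClasses V W₃ =>
      𝒴.coeff (c - lowestWeight V W₃ ν) 0 w w₂).Finite := by
  refine Set.Finite.of_finite_image (f := fun ν : weightClasses V W₃ =>
    toCModZ (-(c - lowestWeight V W₃ ν) - 1)) ((𝒴.finite_classes w w₂).subset ?_) ?_
  · rintro _ ⟨ν, hν, rfl⟩
    exact ⟨_, 0, hν, rfl⟩
  · intro ν _ ν' _ h
    obtain ⟨n, hn⟩ := toCModZ_eq_iff.1 h
    apply Subtype.ext
    rw [← (isLowestWeight_lowestWeight V W₃ ν.2).1, ← (isLowestWeight_lowestWeight V W₃ ν'.2).1]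
    exact toCModZ_eq_iff.2 ⟨n, by linear_combination hn⟩

/-- The bilinear map `(w, w₂) ↦ ∑ ν ∈ Γ(W₃), Res_x x ^ (c - h₃^ν) 𝒴⁰(w, x) w₂`, where `𝒴⁰` is the
coefficient of `(log x) ^ 0` in `𝒴`.  The sum is finite for all `w`, `w₂`. -/
def classSum (𝒴 : IntertwiningOperator V W W₂ W₃) (c : ℂ) : W →ₗ[ℂ] W₂ →ₗ[ℂ] W₃ :=
  LinearMap.mk₂ ℂ
    (fun w w₂ => ∑ᶠ ν : weightClasses V W₃, 𝒴.coeff (c - lowestWeight V W₃ ν) 0 w w₂)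
    (by
      intro w w' w₂
      rw [← finsum_add_distrib (finite_support_classSum 𝒴 c w w₂)
        (finite_support_classSum 𝒴 c w' w₂)]
      simp)
    (by
      intro r w w₂
      rw [smul_finsum]
      simp)
    (by
      intro w w₂ w₂'
      rw [← finsum_add_distrib (finite_support_classSum 𝒴 c w w₂)
        (finite_support_classSum 𝒴 c w w₂')]
      simp)
    (by
      intro r w w₂
      rw [smul_finsum]
      simp)

/-- The map `ϑ_𝒴 : U^∞(W) → Hom(W₂, W₃)`.  For `w ∈ W_[a]` and `w₂ ∈ (W₂)_[b]` of level `l`, where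
`b` is in the class `μ`, the element `ϑ_𝒴([w]_{kl}) w₂` is
`∑ ν ∈ Γ(W₃), Res_x x ^ (h₂^μ - h₃^ν + l - k - 1) 𝒴⁰(x ^ a w, x) w₂`. -/
def thetaIntertwining (𝒴 : IntertwiningOperator V W W₂ W₃) : UInf W →ₗ[ℂ] W₂ →ₗ[ℂ] W₃ :=
  matrixOperator V fun k l =>
    gradedLift (wtSpace V W) (wtSpace_isInternal V W) fun a =>
      (gradedLift (wtSpace V W₂) (wtSpace_isInternal V W₂) fun b =>
        (classSum 𝒴 (lowestWeight V W₂ (toCModZ b) + l - k - 1 + a)).flip).flip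

end Intertwining

/-- `Q^∞(W)`, the intersection of `ker ϑ_𝒴` over all lower-bounded generalized modules `W₂`, `W₃`
and all intertwining operators `𝒴` of type `(W₃ over W W₂)`. -/
def QInfMod (V : Type u) [AddCommGroup V] [Module ℂ V] [GradingRestrictedVertexAlgebra V]
    (W : Type v) [AddCommGroup W] [Module ℂ W] [LowerBoundedGeneralizedModule V W] :
    Submodule ℂ (UInf W) :=
  ⨅ (W₂ : Type w) (_ : AddCommGroup W₂) (_ : Module ℂ W₂) (_ : LowerBoundedGeneralizedModule V W₂)
    (W₃ : Type w) (_ : AddCommGroup W₃) (_ : Module ℂ W₃) (_ : LowerBoundedGeneralizedModule V W₃)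
    (𝒴 : IntertwiningOperator V W W₂ W₃), LinearMap.ker (thetaIntertwining 𝒴)

/-! ### Associative algebras and bimodules -/

/-- The bilinear product `mul` is associative with identity `one`. -/
structure IsAssocAlgebra {A : Type*} [AddCommGroup A] [Module ℂ A] (mul : A →ₗ[ℂ] A →ₗ[ℂ] A)
    (one : A) : Prop where
  mul_assoc : ∀ a b c, mul (mul a b) c = mul a (mul b c)
  one_mul : ∀ a, mul one a = a
  mul_one : ∀ a, mul a one = a

/-- The bilinear actions `l` and `r` make `M` a (unital) bimodule for the algebra `A`. -/
structure IsBimodule {A : Type*} [AddCommGroup A] [Module ℂ A] (mul : A →ₗ[ℂ] A →ₗ[ℂ] A) (one : A)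
    {M : Type*} [AddCommGroup M] [Module ℂ M] (l : A →ₗ[ℂ] M →ₗ[ℂ] M) (r : M →ₗ[ℂ] A →ₗ[ℂ] M) :
    Prop where
  one_left : ∀ x, l one x = x
  mul_left : ∀ a b x, l (mul a b) x = l a (l b x)
  one_right : ∀ x, r x one = x
  mul_right : ∀ x a b, r x (mul a b) = r (r x a) b
  left_right : ∀ a x b, r (l a x) b = l a (r x b)

/-- The left and right `⋄`-actions of `U^∞(V)` on `U^∞(W)` induce well-defined actions of
`A^∞(V)`, with product `mul`, on `U^∞(W) / S`, and these make it an `A^∞(V)`-bimodule. -/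
def InducesBimodule {V : Type u} [AddCommGroup V] [Module ℂ V] [GradingRestrictedVertexAlgebra V]
    {W : Type v} [AddCommGroup W] [Module ℂ W] [LowerBoundedGeneralizedModule V W]
    (mul : AInfAlg.{u, w} V →ₗ[ℂ] AInfAlg.{u, w} V →ₗ[ℂ] AInfAlg.{u, w} V)
    (S : Submodule ℂ (UInf W)) : Prop :=
  ∃ (l : AInfAlg.{u, w} V →ₗ[ℂ] (UInf W ⧸ S) →ₗ[ℂ] (UInf W ⧸ S))
    (r : (UInf W ⧸ S) →ₗ[ℂ] AInfAlg.{u, w} V →ₗ[ℂ] (UInf W ⧸ S)),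
    (∀ (𝔳 : UInf V) (𝔴 : UInf W), l (Submodule.Quotient.mk 𝔳) (Submodule.Quotient.mk 𝔴) =
      Submodule.Quotient.mk (leftAct V W 𝔳 𝔴)) ∧
    (∀ (𝔳 : UInf V) (𝔴 : UInf W), r (Submodule.Quotient.mk 𝔴) (Submodule.Quotient.mk 𝔳) =
      Submodule.Quotient.mk (rightAct V W 𝔴 𝔳)) ∧
    IsBimodule mul (Submodule.Quotient.mk (oneInf V)) l r

end

/-!
The whole proposition follows from the two product formulas for `ϑ_𝒴` and the product formula for
`ϑ_W`.  The kernels of the maps `ϑ` are then stable under the `⋄`-actions, and every identity of an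
associative algebra or bimodule holds modulo these kernels because composition of operators is
associative and `ϑ_W(1^∞) = id` (`thetaModule_oneInf`).  The conditions which make the quotient by
a subspace a bimodule say that certain elements belong to it (`IsDiamondStable`), so they pass from
the kernels to their intersection `Q^∞(W)`.

The product formulas may be checked on matrix units with homogeneous entries, because `ϑ([w]_{nl})`
maps level `l` to level `n` (`matrixOperator_leftDiamond`, `matrixOperator_rightDiamond`).  For
`ϑ_𝒴` this needs the weights of the coefficients of a logarithmic intertwining operator
(`IntertwiningOperator.coeff_mem_wtSpace`).  On homogeneous vectors, `⋄` is a combination, with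
coefficients `binom(A, m)` for `0 ≤ m ≤ n`, of sums `∑ i, binom(q, i) v_{s+i} w`, which are one side
of the Jacobi identity.  One of the two terms on the other side vanishes for weight reasons, and so
does every product in the other term whose intermediate vector would lie below the lowest weight of
its class.  The coefficient of the `p`-th of the remaining products is
`∑ m ≤ p, binom(A, m) (-1) ^ (p - m) binom(A - m, p - m) = binom(A, p) (1 - 1) ^ p`, so that only
the product with `p = 0` survives, and this is the composition
(`JacobiIdentity.sum_left`, `JacobiIdentity.sum_right`).
-/

/-! ### Collapsing binomial sums with the Jacobi identity -/

theorem sum_choose_mul_neg_one_pow_mul_choose (A : ℤ) (p : ℕ) :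
    ∑ m ∈ Finset.range (p + 1),
      Ring.choose A m * ((-1) ^ (p - m) * Ring.choose (A - m) (p - m)) =
        if p = 0 then 1 else 0 := by
  have h : ∀ m ∈ Finset.range (p + 1),
      Ring.choose A m * ((-1) ^ (p - m) * Ring.choose (A - m) (p - m)) =
        Ring.choose A p * ((-1) ^ p * ((-1) ^ m * (p.choose m : ℤ))) := by
    intro m hm
    have hmp : m ≤ p := Nat.lt_succ_iff.1 (Finset.mem_range.1 hm)
    have h1 := Ring.choose_smul_choose A hmp
    have h2 : (-1 : ℤ) ^ p * (-1) ^ m = (-1) ^ (p - m) := by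
      rw [← pow_add, show p + m = p - m + 2 * m by omega, pow_add, pow_mul]
      simp
    rw [nsmul_eq_mul] at h1
    linear_combination ((-1 : ℤ) ^ (p - m)) * (-h1) -
      (p.choose m : ℤ) * Ring.choose A p * h2
  rw [Finset.sum_congr rfl h, ← Finset.mul_sum, ← Finset.mul_sum, Int.alternating_sum_range_choose]
  split_ifs with h0
  · simp [h0]
  · simp

/-- All the terms of the double sum other than `F 0` cancel: the coefficient of `F p` is
`binom(A, p) (1 - 1) ^ p`. -/
theorem sum_choose_smul_finsum_eq {M : Type*} [AddCommGroup M] [Module ℂ M] (A : ℤ) (n : ℕ)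
    (F : ℕ → M) (hF : ∀ p, n < p → F p = 0) :
    ∑ m ∈ Finset.range (n + 1), ((Ring.choose A m : ℤ) : ℂ) •
      ∑ᶠ i : ℕ, ((-1 : ℂ) ^ i * ((Ring.choose (A - m) i : ℤ) : ℂ)) • F (m + i) = F 0 := by
  have h1 : ∀ m ∈ Finset.range (n + 1), ((Ring.choose A m : ℤ) : ℂ) •
      ∑ᶠ i : ℕ, ((-1 : ℂ) ^ i * ((Ring.choose (A - m) i : ℤ) : ℂ)) • F (m + i) =
      ∑ i ∈ Finset.range (n + 1 - m), (((Ring.choose A m : ℤ) : ℂ) *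
        ((-1 : ℂ) ^ i * ((Ring.choose (A - m) i : ℤ) : ℂ))) • F (m + i) := by
    intro m _
    rw [finsum_eq_sum_of_support_subset (s := Finset.range (n + 1 - m)), Finset.smul_sum]
    · simp only [smul_smul]
    · intro i hi
      by_contra hni
      apply hi
      simp only [Finset.coe_range, Set.mem_Iio, not_lt] at hni
      simp only
      rw [hF _ (by omega), smul_zero]
  rw [Finset.sum_congr rfl h1, ← Finset.sum_range_diag_flip (n + 1) fun m i =>
    (((Ring.choose A m : ℤ) : ℂ) * ((-1 : ℂ) ^ i * ((Ring.choose (A - m) i : ℤ) : ℂ))) • F (m + i)]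
  have h2 : ∀ p ∈ Finset.range (n + 1), ∑ m ∈ Finset.range (p + 1),
      (((Ring.choose A m : ℤ) : ℂ) * ((-1 : ℂ) ^ (p - m) *
        ((Ring.choose (A - m) (p - m) : ℤ) : ℂ))) • F (m + (p - m)) =
      if p = 0 then F 0 else 0 := by
    intro p _
    have h3 : ∀ m ∈ Finset.range (p + 1), (((Ring.choose A m : ℤ) : ℂ) * ((-1 : ℂ) ^ (p - m) *
        ((Ring.choose (A - m) (p - m) : ℤ) : ℂ))) • F (m + (p - m)) =
        ((Ring.choose A m * ((-1) ^ (p - m) * Ring.choose (A - m) (p - m)) : ℤ) : ℂ) • F p := by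
      intro m hm
      have := Finset.mem_range.1 hm
      rw [show m + (p - m) = p by omega]
      push_cast
      rfl
    rw [Finset.sum_congr rfl h3, ← Finset.sum_smul, ← Int.cast_sum,
      sum_choose_mul_neg_one_pow_mul_choose]
    split_ifs with h0
    · simp [h0]
    · simp
  rw [Finset.sum_congr rfl h2]
  simp

section Collapse

variable {I V W W₂ W₃ : Type*} [Ring I] [AddCommGroup V] [Module ℂ V] [AddCommGroup W] [Module ℂ W]
  [AddCommGroup W₂] [Module ℂ W₂] [AddCommGroup W₃] [Module ℂ W₃]
  {Y₁ : ℤ → V →ₗ[ℂ] W →ₗ[ℂ] W} {Y₂ : ℤ → V →ₗ[ℂ] W₂ →ₗ[ℂ] W₂} {Y₃ : ℤ → V →ₗ[ℂ] W₃ →ₗ[ℂ] W₃}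
  {𝒴 : I → W →ₗ[ℂ] W₂ →ₗ[ℂ] W₃}

/-- If `v_{q+i} x = 0` for `i ≥ 0`, then the Jacobi identity expresses the operators of the vectors
`v_{s+i} w` through the products `v_r 𝒴_t(w)` alone, and the binomial sum over `m` isolates one
of these products. -/
theorem JacobiIdentity.sum_left
    (hJ : JacobiIdentity (fun n v w => Y₁ n v w) (fun n v w => Y₂ n v w) (fun n v w => Y₃ n v w)
      (fun n w x => 𝒴 n w x))
    (A q : ℤ) (n : ℕ) (N : I) (v : V) (w : W) (x : W₂)
    (h2 : ∀ i : ℕ, Y₂ (q + i) v x = 0) (h3 : ∀ p : ℕ, n < p → 𝒴 (N + p) w x = 0) :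
    ∑ m ∈ Finset.range (n + 1), ((Ring.choose A m : ℤ) : ℂ) •
      ∑ᶠ i : ℕ, ((Ring.choose q i : ℤ) : ℂ) • 𝒴 (q + (N + m) - i) (Y₁ (A - m + i) v w) x =
        Y₃ (q + A) v (𝒴 N w x) := by
  have h := sum_choose_smul_finsum_eq A n (fun p => Y₃ (q + A - p) v (𝒴 (N + p) w x))
    (fun p hp => by rw [h3 p hp, map_zero])
  simp only [Nat.cast_zero, sub_zero, add_zero] at h
  rw [← h]
  refine Finset.sum_congr rfl fun m _ => ?_
  rw [hJ (A - m) q (N + m) v w x]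
  simp only [h2, map_zero, smul_zero, finsum_zero, sub_zero]
  congr 1
  refine finsum_congr fun i => ?_
  rw [show q + (A - m) - i = q + A - ((m + i : ℕ) : ℤ) by push_cast; ring, Nat.cast_add (R := I),
    add_assoc]

/-- If `𝒴_{N+i}(w) x = 0` for `i ≥ 0`, then the Jacobi identity expresses the operators of the
vectors `v_{s+i} w` through the products `𝒴_t(w) v_r` alone, and the binomial sum over `m`
isolates one of these products. -/
theorem JacobiIdentity.sum_right
    (hJ : JacobiIdentity (fun n v w => Y₁ n v w) (fun n v w => Y₂ n v w) (fun n v w => Y₃ n v w)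
      (fun n w x => 𝒴 n w x))
    (A q : ℤ) (n : ℕ) (N : I) (v : V) (w : W) (x : W₂)
    (h2 : ∀ p : ℕ, n < p → Y₂ (q + p) v x = 0) (h3 : ∀ i : ℕ, 𝒴 (N + i) w x = 0) :
    ∑ m ∈ Finset.range (n + 1), ((Ring.choose A m : ℤ) : ℂ) •
      ∑ᶠ i : ℕ, ((-1 : ℂ) ^ (A - m + i + 1) *
          ((Ring.choose (-(q + m) - 1 + i) i : ℤ) : ℂ)) •
        𝒴 ((q + m : ℤ) + N - i) (Y₁ (A - m + i) v w) x =
        𝒴 (N + A) w (Y₂ q v x) := by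
  have h := sum_choose_smul_finsum_eq A n (fun p => 𝒴 (N + A - p) w (Y₂ (q + p) v x))
    (fun p hp => by rw [h2 p hp, map_zero])
  simp only [Nat.cast_zero, sub_zero, add_zero] at h
  rw [← h]
  refine Finset.sum_congr rfl fun m _ => ?_
  congr 1
  have hz : (-1 : ℂ) ≠ 0 := by norm_num
  -- `binom(r + i - 1, i) = (-1) ^ i binom(-r, i)` brings the left side into Jacobi form
  have h4 : ∀ i : ℕ, ((-1 : ℂ) ^ (A - m + i + 1) *
      ((Ring.choose (-(q + m) - 1 + i) i : ℤ) : ℂ)) •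
        𝒴 ((q + m : ℤ) + N - i) (Y₁ (A - m + i) v w) x =
      (-(-1 : ℂ) ^ (A - m)) • (((Ring.choose (q + m) i : ℤ) : ℂ) •
        𝒴 ((q + m : ℤ) + N - i) (Y₁ (A - m + i) v w) x) := by
    intro i
    have hc := Ring.choose_neg (-(q + m)) i
    rw [neg_neg, show -(q + m) + (i : ℤ) - 1 = -(q + m) - 1 + i by ring] at hc
    rw [smul_smul, hc, zpow_add₀ hz, zpow_add₀ hz, zpow_natCast, zpow_one]
    congr 1
    rw [Units.smul_def, Int.negOnePow_def]
    simp
    ring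
  rw [finsum_congr h4, ← smul_finsum, hJ (A - m) (q + m) N v w x]
  simp only [h3, map_zero, smul_zero, finsum_zero, zero_sub, smul_neg, neg_smul, neg_neg]
  rw [smul_finsum]
  refine finsum_congr fun i => ?_
  rw [smul_smul, ← mul_assoc, zpow_add₀ hz, ← mul_assoc, ← mul_zpow, zpow_natCast]
  simp only [neg_mul_neg, one_mul, one_zpow, Nat.cast_add, Int.cast_sub, Int.cast_natCast]
  rw [show N + ((A : I) - m) - i = N + A - (m + i) by abel, add_assoc]

end Collapse

/-! ### Weights -/

theorem mem_maxGenEigenspace_of_sub {M : Type*} [AddCommGroup M] [Module ℂ M] (T : Module.End ℂ M)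
    (a : ℂ) (x : M) (h : T x - a • x ∈ T.maxGenEigenspace a) : x ∈ T.maxGenEigenspace a := by
  rw [Module.End.mem_maxGenEigenspace] at h ⊢
  obtain ⟨k, hk⟩ := h
  refine ⟨k + 1, ?_⟩
  rw [pow_succ, Module.End.mul_apply]
  simpa [LinearMap.sub_apply] using hk

/-- Induction on the nilpotency degree of `T - a` at `x`. -/
theorem maxGenEigenspace_induction {M : Type*} [AddCommGroup M] [Module ℂ M] (T : Module.End ℂ M)
    (a : ℂ) {P : M → Prop} (h0 : P 0) (hs : ∀ x, P (T x - a • x) → P x) {x : M}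
    (hx : x ∈ T.maxGenEigenspace a) : P x := by
  rw [Module.End.mem_maxGenEigenspace] at hx
  obtain ⟨k, hk⟩ := hx
  induction k generalizing x with
  | zero => simpa using (by simpa using hk : x = 0) ▸ h0
  | succ k ih =>
    refine hs x (ih ?_)
    rw [pow_succ, Module.End.mul_apply] at hk
    simpa [LinearMap.sub_apply] using hk

/-- A linear map is determined by its values on the homogeneous elements. -/
theorem linearMap_ext_of_isInternal {ι M N : Type*} [DecidableEq ι] [AddCommGroup M] [Module ℂ M]
    [AddCommGroup N] [Module ℂ N] {𝒜 : ι → Submodule ℂ M} (h : DirectSum.IsInternal 𝒜)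
    {f g : M →ₗ[ℂ] N} (hfg : ∀ i, ∀ x ∈ 𝒜 i, f x = g x) : f = g := by
  rw [← LinearMap.eqLocus_eq_top, eq_top_iff, ← h.submodule_iSup_eq_top, iSup_le_iff]
  exact fun i x hx => hfg i x hx

section Weights

variable {V : Type*} [AddCommGroup V] [Module ℂ V] [GradingRestrictedVertexAlgebra V]
variable {W : Type*} [AddCommGroup W] [Module ℂ W] [LowerBoundedGeneralizedModule V W]
variable {W₂ : Type*} [AddCommGroup W₂] [Module ℂ W₂] [LowerBoundedGeneralizedModule V W₂]
variable {W₃ : Type*} [AddCommGroup W₃] [Module ℂ W₃] [LowerBoundedGeneralizedModule V W₃]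

theorem mem_homSpace {d : ℤ} {v : V} :
    v ∈ homSpace V d ↔ GradingRestrictedVertexAlgebra.L0 v = (d : ℂ) • v :=
  Module.End.mem_eigenspace_iff

theorem vac_mem_homSpace : (GradingRestrictedVertexAlgebra.vac : V) ∈ homSpace V 0 := by
  rw [mem_homSpace, GradingRestrictedVertexAlgebra.vac_weight]
  simp

theorem mode_mem_homSpace {d e : ℤ} {v v' : V} (hv : v ∈ homSpace V d) (hv' : v' ∈ homSpace V e)
    (p : ℤ) :
    mode (GradingRestrictedVertexAlgebra.Y (V := V)) p v v' ∈ homSpace V (e + d - p - 1) := by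
  have h := GradingRestrictedVertexAlgebra.L0_commutator v p v'
  rw [mem_homSpace] at *
  rw [hv, hv', map_smul, map_smul, LinearMap.smul_apply, sub_eq_iff_eq_add] at h
  rw [h, ← add_smul, ← add_smul]
  congr 1
  push_cast
  ring

theorem actionMode_mem_wtSpace {d : ℤ} {v : V} (hv : v ∈ homSpace V d) {a : ℂ} {x : W}
    (hx : x ∈ wtSpace V W a) (p : ℤ) : actionMode V W p v x ∈ wtSpace V W (a + d - p - 1) := by
  refine maxGenEigenspace_induction (LowerBoundedGeneralizedModule.L0 V (W := W)) a
    (P := fun x => actionMode V W p v x ∈ wtSpace V W (a + d - p - 1)) (by simp) ?_ hx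
  intro x ih
  apply mem_maxGenEigenspace_of_sub
  have h := LowerBoundedGeneralizedModule.L0_commutator v p x
  rw [mem_homSpace.1 hv, map_smul, LinearMap.smul_apply, sub_eq_iff_eq_add] at h
  rw [map_sub, map_smul] at ih
  have e : LowerBoundedGeneralizedModule.L0 V (actionMode V W p v x) -
      (a + d - p - 1) • actionMode V W p v x =
      actionMode V W p v (LowerBoundedGeneralizedModule.L0 V x) - a • actionMode V W p v x := by
    unfold actionMode
    rw [h]
    module
  rw [e]
  exact ih

/-- Besides the nilpotency degrees of `L(0) - a` at `w` and of `L(0) - b` at `x`, the induction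
runs downwards over the powers of `log x`, because of the summand
`(k + 1) 𝒴_{n,k+1}(w) x` of the `L(-1)`-derivative property. -/
theorem IntertwiningOperator.coeff_mem_wtSpace (𝒴 : IntertwiningOperator V W W₂ W₃) {a b : ℂ}
    {w : W} (hw : w ∈ wtSpace V W a) {x : W₂} (hx : x ∈ wtSpace V W₂ b) (n : ℂ) (k : ℕ) :
    𝒴.coeff n k w x ∈ wtSpace V W₃ (a + b - n - 1) := by
  refine maxGenEigenspace_induction (LowerBoundedGeneralizedModule.L0 V (W := W)) a
    (P := fun w => ∀ x ∈ wtSpace V W₂ b, ∀ k, 𝒴.coeff n k w x ∈ wtSpace V W₃ (a + b - n - 1))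
    (by simp) ?_ hw x hx k
  intro w ihw x hx
  refine maxGenEigenspace_induction (LowerBoundedGeneralizedModule.L0 V (W := W₂)) b
    (P := fun x => x ∈ wtSpace V W₂ b → ∀ k, 𝒴.coeff n k w x ∈ wtSpace V W₃ (a + b - n - 1))
    (by simp) ?_ hx hx
  clear hx x
  intro x ihx hx
  have hx' : LowerBoundedGeneralizedModule.L0 V x - b • x ∈ wtSpace V W₂ b := by
    refine Submodule.sub_mem _ ?_ (Submodule.smul_mem _ _ hx)
    exact Module.End.mapsTo_maxGenEigenspace_of_comm rfl b hx
  have step : ∀ k, 𝒴.coeff n (k + 1) w x ∈ wtSpace V W₃ (a + b - n - 1) →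
      𝒴.coeff n k w x ∈ wtSpace V W₃ (a + b - n - 1) := by
    intro k ih
    apply mem_maxGenEigenspace_of_sub
    have h1 := 𝒴.L0_commutator n k w x
    have h2 := 𝒴.Lneg_derivative (n + 1) k w x
    have h3 := ihw x hx k
    have h4 := ihx hx' k
    rw [h2, add_sub_cancel_right, sub_eq_iff_eq_add] at h1
    have h5 := Submodule.add_mem _ (Submodule.add_mem _ h3 h4)
      (Submodule.smul_mem _ ((k : ℂ) + 1) ih)
    have e : LowerBoundedGeneralizedModule.L0 V (𝒴.coeff n k w x) -
        (a + b - n - 1) • 𝒴.coeff n k w x =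
        𝒴.coeff n k (LowerBoundedGeneralizedModule.L0 V w - a • w) x +
          𝒴.coeff n k w (LowerBoundedGeneralizedModule.L0 V x - b • x) +
          ((k : ℂ) + 1) • 𝒴.coeff n (k + 1) w x := by
      rw [h1]
      simp only [map_sub, map_smul, LinearMap.sub_apply, LinearMap.smul_apply]
      module
    rw [e]
    exact h5
  obtain ⟨K, hK⟩ := 𝒴.log_finite w x n
  have hge : ∀ k, K ≤ k → 𝒴.coeff n k w x ∈ wtSpace V W₃ (a + b - n - 1) := fun k hk => by
    rw [hK k hk]; exact Submodule.zero_mem _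
  intro k
  rcases le_total K k with hk | hk
  · exact hge k hk
  · exact Nat.decreasingInduction
      (motive := fun k _ => 𝒴.coeff n k w x ∈ wtSpace V W₃ (a + b - n - 1))
      (fun k _ => step k) (hge K le_rfl) hk

theorem wtSpace_lowestWeight_sub_eq_bot {μ : CModZ} (hμ : μ ∈ weightClasses V W) {j : ℕ}
    (hj : 0 < j) : wtSpace V W (lowestWeight V W μ - j) = ⊥ :=
  (isLowestWeight_lowestWeight V W hμ).2.2 j hj

/-- A vector whose weight lies below the lowest weight of its class is zero. -/
theorem eq_zero_of_mem_wtSpace_lowestWeight_sub {μ : CModZ} (hμ : μ ∈ weightClasses V W) {j : ℕ}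
    (hj : 0 < j) {a : ℂ} (ha : a = lowestWeight V W μ - j) {x : W} (hx : x ∈ wtSpace V W a) :
    x = 0 := by
  rw [ha, wtSpace_lowestWeight_sub_eq_bot hμ hj] at hx
  exact hx

theorem toCModZ_add_intCast (a : ℂ) (n : ℤ) : toCModZ (a + n) = toCModZ a :=
  (toCModZ_eq_iff.2 ⟨n, rfl⟩).symm

variable (V W) in
/-- The subspace `W_⟨l⟩` of the canonical `ℕ`-grading of `W`. -/
noncomputable def levelSpace (l : ℕ) : Submodule ℂ W :=
  LinearMap.eqLocus (levelComponents V W) (Finsupp.lsingle l)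

theorem mem_levelSpace {l : ℕ} {x : W} :
    x ∈ levelSpace V W l ↔ levelComponents V W x = Finsupp.single l x := Iff.rfl

theorem mem_levelSpace_of_mem_wtSpace {μ : CModZ} (hμ : μ ∈ weightClasses V W) {l : ℕ} {a : ℂ}
    (ha : a = lowestWeight V W μ + l) {x : W} (hx : x ∈ wtSpace V W a) : x ∈ levelSpace V W l :=
  levelComponents_of_mem V W hμ l (ha ▸ hx)

end Weights

/-! ### Operators given by column-finite matrices -/

section Matrices

variable {V : Type*} [AddCommGroup V] [Module ℂ V] [GradingRestrictedVertexAlgebra V]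
variable {U : Type*} [AddCommGroup U] [Module ℂ U]
variable {W₂ : Type*} [AddCommGroup W₂] [Module ℂ W₂] [LowerBoundedGeneralizedModule V W₂]
variable {W₃ : Type*} [AddCommGroup W₃] [Module ℂ W₃] [LowerBoundedGeneralizedModule V W₃]

theorem matrixOperator_apply_of_mem {N : Type*} [AddCommGroup N] [Module ℂ N]
    (θ : ℕ → ℕ → U →ₗ[ℂ] W₂ →ₗ[ℂ] N) (M : UInf U) {l : ℕ} {x : W₂}
    (hx : x ∈ levelSpace V W₂ l) :
    matrixOperator V θ M x = (M l).sum fun k w => θ k l w x := by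
  change (levelComponents V W₂ x).sum (fun l x => (M l).sum fun k w => θ k l w x) = _
  rw [mem_levelSpace.1 hx, Finsupp.sum_single_index]
  simp

/-- Linear maps out of a module agree as soon as they agree on nonzero weight vectors `x`, which are
described here by their class `μ` and level `l`. -/
theorem linearMap_ext_of_levels {N : Type*} [AddCommGroup N] [Module ℂ N] {f g : W₂ →ₗ[ℂ] N}
    (h : ∀ μ ∈ weightClasses V W₂, ∀ l : ℕ, ∀ x ∈ wtSpace V W₂ (lowestWeight V W₂ μ + l),
      f x = g x) : f = g := by
  refine linearMap_ext_of_isInternal (wtSpace_isInternal V W₂) fun b x hx => ?_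
  by_cases hb : wtSpace V W₂ b = ⊥
  · rw [hb, Submodule.mem_bot] at hx
    rw [hx, map_zero, map_zero]
  · rw [eq_lowestWeight_add_level V W₂ hb] at hx
    exact h _ ⟨b, rfl, hb⟩ _ x hx

variable {W : Type*} [AddCommGroup W] [Module ℂ W]

/-- It suffices to check on matrix units that `𝔳 ⋄ 𝔴` acts as the composition, provided that
`[w]_{nl}` maps level `l` into level `n`: then `[v]_{kn'}` acts on the result only for `n' = n`. -/
theorem matrixOperator_leftDiamond (Y : V →ₗ[ℂ] VertexOperator ℂ W)
    (θ : ℕ → ℕ → W →ₗ[ℂ] W₂ →ₗ[ℂ] W₃) (η : ℕ → ℕ → V →ₗ[ℂ] W₃ →ₗ[ℂ] W₃)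
    (hθ : ∀ μ ∈ weightClasses V W₂, ∀ l : ℕ, ∀ x ∈ wtSpace V W₂ (lowestWeight V W₂ μ + l),
      ∀ n w, θ n l w x ∈ levelSpace V W₃ n)
    (h : ∀ μ ∈ weightClasses V W₂, ∀ l : ℕ, ∀ x ∈ wtSpace V W₂ (lowestWeight V W₂ μ + l),
      ∀ k n v w, θ k l (leftEntry V Y k n l v w) x = η k n v (θ n l w x))
    (𝔳 : UInf V) (𝔴 : UInf W) :
    matrixOperator V θ (leftDiamond V Y 𝔳 𝔴) =
      matrixOperator V η 𝔳 ∘ₗ matrixOperator V θ 𝔴 := by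
  refine linearMap_ext_of_levels (V := V) fun μ hμ l x hx => ?_
  have hl := mem_levelSpace_of_mem_wtSpace hμ rfl hx
  rw [LinearMap.comp_apply, matrixOperator_apply_of_mem θ _ hl, matrixOperator_apply_of_mem θ _ hl,
    map_finsuppSum]
  change (((𝔴 l).sum fun n y => (𝔳 n).sum fun k v =>
    Finsupp.single k (leftEntry V Y k n l v y)).sum fun k u => θ k l u x) = _
  rw [Finsupp.sum_sum_index (by simp) (by simp)]
  refine Finsupp.sum_congr fun n _ => ?_
  rw [matrixOperator_apply_of_mem η _ (hθ μ hμ l x hx n _),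
    Finsupp.sum_sum_index (by simp) (by simp)]
  refine Finsupp.sum_congr fun k _ => ?_
  rw [Finsupp.sum_single_index (by simp), h μ hμ l x hx]

/-- The analogue of `matrixOperator_leftDiamond` for the right action. -/
theorem matrixOperator_rightDiamond {N : Type*} [AddCommGroup N] [Module ℂ N]
    (Y : V →ₗ[ℂ] VertexOperator ℂ W)
    (θ : ℕ → ℕ → W →ₗ[ℂ] W₂ →ₗ[ℂ] N) (η : ℕ → ℕ → V →ₗ[ℂ] W₂ →ₗ[ℂ] W₂)
    (hη : ∀ μ ∈ weightClasses V W₂, ∀ l : ℕ, ∀ x ∈ wtSpace V W₂ (lowestWeight V W₂ μ + l),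
      ∀ n v, η n l v x ∈ levelSpace V W₂ n)
    (h : ∀ μ ∈ weightClasses V W₂, ∀ l : ℕ, ∀ x ∈ wtSpace V W₂ (lowestWeight V W₂ μ + l),
      ∀ k n v w, θ k l (rightEntry V Y k n l v w) x = θ k n w (η n l v x))
    (𝔴 : UInf W) (𝔳 : UInf V) :
    matrixOperator V θ (rightDiamond V Y 𝔴 𝔳) =
      matrixOperator V θ 𝔴 ∘ₗ matrixOperator V η 𝔳 := by
  refine linearMap_ext_of_levels (V := V) fun μ hμ l x hx => ?_
  have hl := mem_levelSpace_of_mem_wtSpace hμ rfl hx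
  rw [LinearMap.comp_apply, matrixOperator_apply_of_mem θ _ hl, matrixOperator_apply_of_mem η _ hl,
    map_finsuppSum]
  change (((𝔳 l).sum fun n v => (𝔴 n).sum fun k y =>
    Finsupp.single k (rightEntry V Y k n l v y)).sum fun k u => θ k l u x) = _
  rw [Finsupp.sum_sum_index (by simp) (by simp)]
  refine Finsupp.sum_congr fun n _ => ?_
  rw [matrixOperator_apply_of_mem θ _ (hη μ hμ l x hx n _),
    Finsupp.sum_sum_index (by simp) (by simp)]
  refine Finsupp.sum_congr fun k _ => ?_
  rw [Finsupp.sum_single_index (by simp), h μ hμ l x hx]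

end Matrices

/-! ### Finite sums and homogeneous vectors -/

theorem sum_smul_finsum_finsum_comm {ι N : Type*} [AddCommGroup N] [Module ℂ N] (s : Finset ℕ)
    (c : ℕ → ℂ) (e : ℕ → ℕ → ℂ) (G : ℕ → ℕ → ι → N)
    (h₁ : ∀ m, (Function.support fun i => G m i).Finite)
    (h₂ : ∀ m i, (Function.support (G m i)).Finite) :
    ∑ m ∈ s, c m • ∑ᶠ i, e m i • ∑ᶠ ν, G m i ν = ∑ᶠ ν, ∑ m ∈ s, c m • ∑ᶠ i, e m i • G m i ν := by
  have h₃ : ∀ m ν, ∑ᶠ i, e m i • G m i ν = ∑ i ∈ (h₁ m).toFinset, e m i • G m i ν := fun m ν => by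
    refine finsum_eq_sum_of_support_subset _ fun i hi => ?_
    rw [Set.Finite.coe_toFinset]
    intro h0
    apply hi
    simp only at h0 ⊢
    rw [h0, Pi.zero_apply, smul_zero]
  have h₄ : ∀ m, ∑ᶠ i, e m i • ∑ᶠ ν, G m i ν = ∑ᶠ ν, ∑ᶠ i, e m i • G m i ν := fun m => by
    simp_rw [h₃]
    rw [finsum_sum_comm _ (fun ν i => e m i • G m i ν) fun i _ =>
      (h₂ m i).subset (Function.support_const_smul_subset _ _)]
    simp_rw [← smul_finsum]
    refine finsum_eq_sum_of_support_subset _ fun i hi => ?_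
    rw [Set.Finite.coe_toFinset]
    intro h0
    apply hi
    simp only at h0 ⊢
    rw [h0]
    simp
  simp_rw [h₄, smul_finsum]
  rw [finsum_sum_comm]
  intro m _
  simp_rw [← smul_finsum, h₃]
  refine Set.Finite.subset ((h₁ m).toFinset.finite_toSet.biUnion fun i _ => h₂ m i) fun ν hν => ?_
  by_contra hn
  apply hν
  simp only [Set.mem_iUnion, not_exists] at hn
  simp only
  rw [Finset.sum_eq_zero, smul_zero]
  intro i hi
  rw [Function.notMem_support.1 (hn i hi), smul_zero]

theorem linearMap_ext₂_of_isInternal {ι κ M M' N : Type*} [DecidableEq ι] [DecidableEq κ]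
    [AddCommGroup M] [Module ℂ M] [AddCommGroup M'] [Module ℂ M'] [AddCommGroup N] [Module ℂ N]
    {𝒜 : ι → Submodule ℂ M} (h : DirectSum.IsInternal 𝒜) {𝒜' : κ → Submodule ℂ M'}
    (h' : DirectSum.IsInternal 𝒜') {f g : M →ₗ[ℂ] M' →ₗ[ℂ] N}
    (hfg : ∀ i, ∀ x ∈ 𝒜 i, ∀ j, ∀ y ∈ 𝒜' j, f x y = g x y) : f = g :=
  linearMap_ext_of_isInternal h fun i x hx =>
    linearMap_ext_of_isInternal h' fun j y hy => hfg i x hx j y hy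

theorem linearMap_mem_of_isInternal {ι M N : Type*} [DecidableEq ι] [AddCommGroup M] [Module ℂ M]
    [AddCommGroup N] [Module ℂ N] {𝒜 : ι → Submodule ℂ M} (h : DirectSum.IsInternal 𝒜)
    {f : M →ₗ[ℂ] N} {S : Submodule ℂ N} (hf : ∀ i, ∀ x ∈ 𝒜 i, f x ∈ S) (x : M) : f x ∈ S := by
  have : (⨆ i, 𝒜 i) ≤ S.comap f := iSup_le fun i x hx => hf i x hx
  exact this (h.submodule_iSup_eq_top ▸ Submodule.mem_top)

theorem finsum_mem_submodule {ι N : Type*} [AddCommGroup N] [Module ℂ N] {S : Submodule ℂ N}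
    {f : ι → N} (hf : ∀ i, f i ∈ S) : ∑ᶠ i, f i ∈ S :=
  finsum_induction (· ∈ S) S.zero_mem (fun _ _ => S.add_mem) hf

/-! ### Entries of the products on homogeneous vectors -/

section Entries

variable {V : Type*} [AddCommGroup V] [Module ℂ V]
variable {W : Type*} [AddCommGroup W] [Module ℂ W]
variable {N : Type*} [AddCommGroup N] [Module ℂ N]

theorem map_modeSum (Y : V →ₗ[ℂ] VertexOperator ℂ W) (c : ℕ → ℂ) (s : ℤ) (f : W →ₗ[ℂ] N) (v : V)
    (w : W) : f (modeSum Y c s v w) = ∑ᶠ i : ℕ, c i • f (mode Y (s + i) v w) := by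
  change f (∑ᶠ i : ℕ, c i • mode Y (s + i) v w) = _
  rw [map_finsum _ (finite_support_mode Y c s v w)]
  simp only [map_smul]

theorem finite_support_mode_comp {ι M : Type*} [Zero M]
    (Y : V →ₗ[ℂ] VertexOperator ℂ W) (s : ℤ) (v : V) (w : W) (g : ℕ → ι → W → M)
    (hg : ∀ i ν, g i ν 0 = 0) :
    (Function.support fun (i : ℕ) (ν : ι) => g i ν (mode Y (s + i) v w)).Finite := by
  refine (finite_support_mode Y (fun _ => 1) s v w).subset fun i hi h0 => hi ?_
  simp only [one_smul] at h0
  funext ν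
  change g i ν (mode Y (s + i) v w) = 0
  rw [h0, hg]

variable [GradingRestrictedVertexAlgebra V]

theorem map_leftEntry (Y : V →ₗ[ℂ] VertexOperator ℂ W) (k n l : ℕ) (f : W →ₗ[ℂ] N) {d : ℤ} {v : V}
    (hv : v ∈ homSpace V d) (w : W) :
    f (leftEntry V Y k n l v w) =
      ∑ m ∈ Finset.range (n + 1), ((Ring.choose (-(k : ℤ) + n - l - 1) m : ℤ) : ℂ) •
        ∑ᶠ i : ℕ, ((Ring.choose ((l : ℤ) + d) i : ℤ) : ℂ) •
          f (mode Y ((-(k : ℤ) + n - l - 1) - m + i) v w) := by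
  rw [leftEntry, gradedLift_of_mem _ _ _ hv]
  simp only [LinearMap.sum_apply, LinearMap.smul_apply, map_sum, map_smul, map_modeSum]
  refine Finset.sum_congr rfl fun m _ => ?_
  rw [show -(k : ℤ) + n - l - m - 1 = -(k : ℤ) + n - l - 1 - m by ring]

theorem map_rightEntry (Y : V →ₗ[ℂ] VertexOperator ℂ W) (k n l : ℕ) (f : W →ₗ[ℂ] N) {d : ℤ} {v : V}
    (hv : v ∈ homSpace V d) (w : W) :
    f (rightEntry V Y k n l v w) =
      ∑ m ∈ Finset.range (n + 1), ((Ring.choose (-(k : ℤ) + n - l - 1) m : ℤ) : ℂ) •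
        ∑ᶠ i : ℕ, ((-1 : ℂ) ^ ((-(k : ℤ) + n - l - 1) - m + i + 1) *
            ((Ring.choose (-((d + l - n - 1) + m) - 1 + i) i : ℤ) : ℂ)) •
          f (mode Y ((-(k : ℤ) + n - l - 1) - m + i) v w) := by
  rw [rightEntry, gradedLift_of_mem _ _ _ hv]
  simp only [LinearMap.sum_apply, LinearMap.smul_apply, map_sum, map_smul, map_modeSum]
  refine Finset.sum_congr rfl fun m _ => ?_
  rw [show -(k : ℤ) + n - l - m - 1 = -(k : ℤ) + n - l - 1 - m by ring]
  congr 1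
  refine finsum_congr fun i => ?_
  rw [show (k : ℤ) - d + (-(k : ℤ) + n - l - 1 - m) + i + 1 =
    -((d + l - n - 1) + m) - 1 + i by ring]

end Entries

/-! ### The maps `ϑ_W` and `ϑ_𝒴` on matrix units -/

section Theta

variable {V : Type*} [AddCommGroup V] [Module ℂ V] [GradingRestrictedVertexAlgebra V]
variable {W : Type*} [AddCommGroup W] [Module ℂ W] [LowerBoundedGeneralizedModule V W]
variable {W₂ : Type*} [AddCommGroup W₂] [Module ℂ W₂] [LowerBoundedGeneralizedModule V W₂]
variable {W₃ : Type*} [AddCommGroup W₃] [Module ℂ W₃] [LowerBoundedGeneralizedModule V W₃]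

variable (V W) in
/-- The bilinear map `(v, x) ↦ ϑ_W([v]_{kl}) x` for `x` of level `l`. -/
noncomputable def thetaModuleEntry (k l : ℕ) : V →ₗ[ℂ] W →ₗ[ℂ] W :=
  gradedLift (homSpace V) (homSpace_isInternal V) fun d => actionMode V W (d + l - k - 1)

theorem thetaModule_eq : thetaModule V W = matrixOperator V (thetaModuleEntry V W) := rfl

theorem thetaModuleEntry_of_mem (k l : ℕ) {d : ℤ} {v : V} (hv : v ∈ homSpace V d) :
    thetaModuleEntry V W k l v = actionMode V W (d + l - k - 1) v :=
  gradedLift_of_mem _ _ _ hv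

/-- The bilinear map `(w, x) ↦ ϑ_𝒴([w]_{kl}) x` for `x` of level `l`. -/
noncomputable def thetaIntertwiningEntry (𝒴 : IntertwiningOperator V W W₂ W₃) (k l : ℕ) :
    W →ₗ[ℂ] W₂ →ₗ[ℂ] W₃ :=
  gradedLift (wtSpace V W) (wtSpace_isInternal V W) fun a =>
    (gradedLift (wtSpace V W₂) (wtSpace_isInternal V W₂) fun b =>
      (classSum 𝒴 (lowestWeight V W₂ (toCModZ b) + l - k - 1 + a)).flip).flip

theorem thetaIntertwiningEntry_of_mem (𝒴 : IntertwiningOperator V W W₂ W₃) (k l : ℕ) {a : ℂ} {w : W}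
    (hw : w ∈ wtSpace V W a) {μ : CModZ} (hμ : μ ∈ weightClasses V W₂) {x : W₂}
    (hx : x ∈ wtSpace V W₂ (lowestWeight V W₂ μ + l)) :
    thetaIntertwiningEntry 𝒴 k l w x = ∑ᶠ ν : weightClasses V W₃,
      𝒴.coeff (lowestWeight V W₂ μ + l - k - 1 + a - lowestWeight V W₃ ν) 0 w x := by
  rw [thetaIntertwiningEntry, gradedLift_of_mem _ _ _ hw, LinearMap.flip_apply,
    gradedLift_of_mem _ _ _ hx]
  have h : toCModZ (lowestWeight V W₂ μ + l) = μ := by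
    rw [← Int.cast_natCast (R := ℂ) l, toCModZ_add_intCast]
    exact (isLowestWeight_lowestWeight V W₂ hμ).1
  rw [h]
  rfl

theorem thetaModuleEntry_mem_wtSpace {μ : CModZ} (k l : ℕ) {d : ℤ} {v : V}
    (hv : v ∈ homSpace V d) {x : W} (hx : x ∈ wtSpace V W (lowestWeight V W μ + l)) :
    thetaModuleEntry V W k l v x ∈ wtSpace V W (lowestWeight V W μ + k) := by
  rw [thetaModuleEntry_of_mem k l hv]
  have h := actionMode_mem_wtSpace hv hx (d + l - k - 1)
  rwa [show lowestWeight V W μ + l + d - ((d + l - k - 1 : ℤ) : ℂ) - 1 = lowestWeight V W μ + k by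
    push_cast; ring] at h

theorem thetaModuleEntry_mem_levelSpace {μ : CModZ} (hμ : μ ∈ weightClasses V W) (k l : ℕ) (v : V)
    {x : W} (hx : x ∈ wtSpace V W (lowestWeight V W μ + l)) :
    thetaModuleEntry V W k l v x ∈ levelSpace V W k :=
  linearMap_mem_of_isInternal (homSpace_isInternal V) (f := (thetaModuleEntry V W k l).flip x)
    (fun _ _ hv => mem_levelSpace_of_mem_wtSpace hμ rfl (thetaModuleEntry_mem_wtSpace k l hv hx)) v

theorem thetaIntertwiningEntry_mem_levelSpace (𝒴 : IntertwiningOperator V W W₂ W₃) {μ : CModZ}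
    (hμ : μ ∈ weightClasses V W₂) (k l : ℕ) (w : W) {x : W₂}
    (hx : x ∈ wtSpace V W₂ (lowestWeight V W₂ μ + l)) :
    thetaIntertwiningEntry 𝒴 k l w x ∈ levelSpace V W₃ k := by
  refine linearMap_mem_of_isInternal (wtSpace_isInternal V W)
    (f := (thetaIntertwiningEntry 𝒴 k l).flip x) (fun a w hw => ?_) w
  rw [LinearMap.flip_apply, thetaIntertwiningEntry_of_mem 𝒴 k l hw hμ hx]
  refine finsum_mem_submodule fun ν => mem_levelSpace_of_mem_wtSpace ν.2 ?_
    (𝒴.coeff_mem_wtSpace hw hx _ 0)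
  ring

/-- A mode that would lower the weight of a vector of level `l` by more than `l` annihilates it. -/
theorem actionMode_eq_zero {μ : CModZ} (hμ : μ ∈ weightClasses V W) {d : ℤ} {v : V}
    (hv : v ∈ homSpace V d) {l : ℕ} {x : W} (hx : x ∈ wtSpace V W (lowestWeight V W μ + l)) {p : ℤ}
    (hp : d + l ≤ p) : actionMode V W p v x = 0 := by
  obtain ⟨j, rfl⟩ := Int.le.dest hp
  refine eq_zero_of_mem_wtSpace_lowestWeight_sub hμ (Nat.succ_pos j) ?_
    (actionMode_mem_wtSpace hv hx _)
  push_cast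
  ring

/-- For each class `ν ∈ Γ(W₃)` separately this is `JacobiIdentity.sum_left`: in the Jacobi identity
with exponent `l + d`, the modes `v_{l+d+i}` annihilate `x`, and the coefficient of `𝒴(w, ·) x`
that is `p > n` places beyond the one in `ϑ_𝒴([w]_{nl}) x` has weight `h₃^ν + n - p`. -/
theorem thetaIntertwiningEntry_leftEntry (𝒴 : IntertwiningOperator V W W₂ W₃) {μ : CModZ}
    (hμ : μ ∈ weightClasses V W₂) (k n l : ℕ) (v : V) (w : W) {x : W₂}
    (hx : x ∈ wtSpace V W₂ (lowestWeight V W₂ μ + l)) :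
    thetaIntertwiningEntry 𝒴 k l
        (leftEntry V (LowerBoundedGeneralizedModule.Y (V := V) (W := W)) k n l v w) x =
      thetaModuleEntry V W₃ k n v (thetaIntertwiningEntry 𝒴 n l w x) := by
  refine LinearMap.congr_fun₂ (linearMap_ext₂_of_isInternal (homSpace_isInternal V)
    (wtSpace_isInternal V W)
    (f := (leftEntry V (LowerBoundedGeneralizedModule.Y (V := V) (W := W)) k n l).compr₂
      ((thetaIntertwiningEntry 𝒴 k l).flip x))
    (g := (thetaModuleEntry V W₃ k n).compl₂ ((thetaIntertwiningEntry 𝒴 n l).flip x))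
    fun d v hv a w hw => ?_) v w
  rw [LinearMap.compr₂_apply, LinearMap.compl₂_apply, map_leftEntry _ k n l _ hv,
    thetaModuleEntry_of_mem k n hv, LinearMap.flip_apply,
    thetaIntertwiningEntry_of_mem 𝒴 n l hw hμ hx]
  simp only [LinearMap.flip_apply]
  have h₁ : ∀ p : ℤ, thetaIntertwiningEntry 𝒴 k l (mode LowerBoundedGeneralizedModule.Y p v w) x =
      ∑ᶠ ν : weightClasses V W₃, 𝒴.coeff (lowestWeight V W₂ μ + l - k - 1 + (a + d - p - 1) -
        lowestWeight V W₃ ν) 0 (mode LowerBoundedGeneralizedModule.Y p v w) x := fun p =>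
    thetaIntertwiningEntry_of_mem 𝒴 k l (actionMode_mem_wtSpace hv hw p) hμ hx
  simp_rw [h₁]
  rw [sum_smul_finsum_finsum_comm _ _ _ (fun (m i : ℕ) (ν : weightClasses V W₃) =>
      𝒴.coeff (lowestWeight V W₂ μ + l - k - 1 + (a + d -
        (-(k : ℤ) + n - l - 1 - m + i : ℤ) - 1) - lowestWeight V W₃ ν) 0
        (mode LowerBoundedGeneralizedModule.Y (-(k : ℤ) + n - l - 1 - m + i) v w) x)
      (fun m => finite_support_mode_comp _ _ v w (fun i (ν : weightClasses V W₃) y =>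
        𝒴.coeff (lowestWeight V W₂ μ + l - k - 1 + (a + d -
          (-(k : ℤ) + n - l - 1 - m + i : ℤ) - 1) - lowestWeight V W₃ ν) 0 y x)
        (by simp))
      (fun m i => finite_support_classSum 𝒴 _ _ x),
    map_finsum _ (finite_support_classSum 𝒴 _ w x)]
  refine finsum_congr fun ν => ?_
  have hJ := JacobiIdentity.sum_left (Y₁ := actionMode V W) (Y₂ := actionMode V W₂)
    (Y₃ := actionMode V W₃) (𝒴 := fun n => 𝒴.coeff n 0) (𝒴.jacobi 0)
    (-(k : ℤ) + n - l - 1) (l + d) n (lowestWeight V W₂ μ + l - n - 1 + a - lowestWeight V W₃ ν)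
    v w x (fun i => actionMode_eq_zero hμ hv hx (by omega))
    (fun p hp => eq_zero_of_mem_wtSpace_lowestWeight_sub ν.2 (Nat.sub_pos_of_lt hp)
      (by rw [Nat.cast_sub hp.le]; ring) (𝒴.coeff_mem_wtSpace hw hx _ 0))
  rw [show (d + n - k - 1 : ℤ) = l + d + (-(k : ℤ) + n - l - 1) by ring, ← hJ]
  refine Finset.sum_congr rfl fun m _ => ?_
  congr 1
  refine finsum_congr fun i => ?_
  congr 1
  change 𝒴.coeff _ 0 (actionMode V W _ v w) x = 𝒴.coeff _ 0 (actionMode V W _ v w) x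
  congr 3
  push_cast
  ring

/-- For each class `ν ∈ Γ(W₃)` separately this is `JacobiIdentity.sum_right`: now the coefficients
`𝒴_{N+i}(w) x` with `N = h₂^μ + l + a - h₃^ν` vanish, since they have weight `h₃^ν - i - 1`. -/
theorem thetaIntertwiningEntry_rightEntry (𝒴 : IntertwiningOperator V W W₂ W₃) {μ : CModZ}
    (hμ : μ ∈ weightClasses V W₂) (k n l : ℕ) (v : V) (w : W) {x : W₂}
    (hx : x ∈ wtSpace V W₂ (lowestWeight V W₂ μ + l)) :
    thetaIntertwiningEntry 𝒴 k l
        (rightEntry V (LowerBoundedGeneralizedModule.Y (V := V) (W := W)) k n l v w) x =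
      thetaIntertwiningEntry 𝒴 k n w (thetaModuleEntry V W₂ n l v x) := by
  refine LinearMap.congr_fun₂ (linearMap_ext₂_of_isInternal (homSpace_isInternal V)
    (wtSpace_isInternal V W)
    (f := (rightEntry V (LowerBoundedGeneralizedModule.Y (V := V) (W := W)) k n l).compr₂
      ((thetaIntertwiningEntry 𝒴 k l).flip x))
    (g := (thetaIntertwiningEntry 𝒴 k n).flip ∘ₗ (thetaModuleEntry V W₂ n l).flip x)
    fun d v hv a w hw => ?_) v w
  rw [LinearMap.compr₂_apply, LinearMap.comp_apply, map_rightEntry _ k n l _ hv,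
    LinearMap.flip_apply, LinearMap.flip_apply, thetaIntertwiningEntry_of_mem 𝒴 k n hw hμ
      (thetaModuleEntry_mem_wtSpace n l hv hx), thetaModuleEntry_of_mem n l hv]
  simp only [LinearMap.flip_apply]
  have h₁ : ∀ p : ℤ, thetaIntertwiningEntry 𝒴 k l (mode LowerBoundedGeneralizedModule.Y p v w) x =
      ∑ᶠ ν : weightClasses V W₃, 𝒴.coeff (lowestWeight V W₂ μ + l - k - 1 + (a + d - p - 1) -
        lowestWeight V W₃ ν) 0 (mode LowerBoundedGeneralizedModule.Y p v w) x := fun p =>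
    thetaIntertwiningEntry_of_mem 𝒴 k l (actionMode_mem_wtSpace hv hw p) hμ hx
  simp_rw [h₁]
  rw [sum_smul_finsum_finsum_comm _ _ _ (fun (m i : ℕ) (ν : weightClasses V W₃) =>
      𝒴.coeff (lowestWeight V W₂ μ + l - k - 1 + (a + d -
        (-(k : ℤ) + n - l - 1 - m + i : ℤ) - 1) - lowestWeight V W₃ ν) 0
        (mode LowerBoundedGeneralizedModule.Y (-(k : ℤ) + n - l - 1 - m + i) v w) x)
      (fun m => finite_support_mode_comp _ _ v w (fun i (ν : weightClasses V W₃) y =>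
        𝒴.coeff (lowestWeight V W₂ μ + l - k - 1 + (a + d -
          (-(k : ℤ) + n - l - 1 - m + i : ℤ) - 1) - lowestWeight V W₃ ν) 0 y x)
        (by simp))
      (fun m i => finite_support_classSum 𝒴 _ _ x)]
  refine finsum_congr fun ν => ?_
  have hJ := JacobiIdentity.sum_right (Y₁ := actionMode V W) (Y₂ := actionMode V W₂)
    (Y₃ := actionMode V W₃) (𝒴 := fun n => 𝒴.coeff n 0) (𝒴.jacobi 0) (-(k : ℤ) + n - l - 1)
    (d + l - n - 1) n (lowestWeight V W₂ μ + l + a - lowestWeight V W₃ ν) v w x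
    (fun p hp => actionMode_eq_zero hμ hv hx (by omega))
    (fun i => eq_zero_of_mem_wtSpace_lowestWeight_sub ν.2 (Nat.succ_pos i)
      (by push_cast; ring) (𝒴.coeff_mem_wtSpace hw hx _ 0))
  rw [show lowestWeight V W₂ μ + n - k - 1 + a - lowestWeight V W₃ ν = lowestWeight V W₂ μ + l + a -
    lowestWeight V W₃ ν + ((-(k : ℤ) + n - l - 1 : ℤ) : ℂ) by push_cast; ring, ← hJ]
  refine Finset.sum_congr rfl fun m _ => ?_
  congr 1
  refine finsum_congr fun i => ?_
  congr 1
  change 𝒴.coeff _ 0 (actionMode V W _ v w) x = 𝒴.coeff _ 0 (actionMode V W _ v w) x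
  congr 3
  push_cast
  ring

/-- The analogue of `thetaIntertwiningEntry_leftEntry` with `Y_W` in place of `𝒴`; the powers of `x`
are integers here, so there is no sum over classes. -/
theorem thetaModuleEntry_leftEntry {μ : CModZ}
    (hμ : μ ∈ weightClasses V W) (k n l : ℕ) (u v : V) {x : W}
    (hx : x ∈ wtSpace V W (lowestWeight V W μ + l)) :
    thetaModuleEntry V W k l
        (leftEntry V (GradingRestrictedVertexAlgebra.Y (V := V)) k n l u v) x =
      thetaModuleEntry V W k n u (thetaModuleEntry V W n l v x) := by
  refine LinearMap.congr_fun₂ (linearMap_ext₂_of_isInternal (homSpace_isInternal V)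
    (homSpace_isInternal V)
    (f := (leftEntry V (GradingRestrictedVertexAlgebra.Y (V := V)) k n l).compr₂
      ((thetaModuleEntry V W k l).flip x))
    (g := (thetaModuleEntry V W k n).compl₂ ((thetaModuleEntry V W n l).flip x))
    fun d u hu e v hv => ?_) u v
  rw [LinearMap.compr₂_apply, LinearMap.compl₂_apply, map_leftEntry _ k n l _ hu,
    thetaModuleEntry_of_mem k n hu, LinearMap.flip_apply, thetaModuleEntry_of_mem n l hv]
  simp only [LinearMap.flip_apply]
  have h₁ : ∀ p : ℤ, thetaModuleEntry V W k l (mode GradingRestrictedVertexAlgebra.Y p u v) x =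
      actionMode V W (e + d - p - 1 + l - k - 1) (mode GradingRestrictedVertexAlgebra.Y p u v) x :=
    fun p => by rw [thetaModuleEntry_of_mem k l (mode_mem_homSpace hu hv p)]
  simp_rw [h₁]
  have hJ := JacobiIdentity.sum_left
    (Y₁ := mode (GradingRestrictedVertexAlgebra.Y (V := V))) (Y₂ := actionMode V W)
    (Y₃ := actionMode V W) (𝒴 := actionMode V W) LowerBoundedGeneralizedModule.jacobi
    (-(k : ℤ) + n - l - 1) (l + d) n (e + l - n - 1) u v x
    (fun i => actionMode_eq_zero hμ hu hx (by omega))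
    (fun p hp => actionMode_eq_zero hμ hv hx (by omega))
  rw [show (d + n - k - 1 : ℤ) = l + d + (-(k : ℤ) + n - l - 1) by ring, ← hJ]
  refine Finset.sum_congr rfl fun m _ => ?_
  congr 1
  refine finsum_congr fun i => ?_
  congr 1
  exact congrArg (fun p => actionMode V W p _ x) (by push_cast; ring)

theorem thetaIntertwining_leftAct (𝒴 : IntertwiningOperator V W W₂ W₃) (𝔳 : UInf V) (𝔴 : UInf W) :
    thetaIntertwining 𝒴 (leftAct V W 𝔳 𝔴) = thetaModule V W₃ 𝔳 ∘ₗ thetaIntertwining 𝒴 𝔴 :=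
  matrixOperator_leftDiamond _ _ _
    (fun _ hμ l _ hx n w => thetaIntertwiningEntry_mem_levelSpace 𝒴 hμ n l w hx)
    (fun _ hμ l _ hx k n v w => thetaIntertwiningEntry_leftEntry 𝒴 hμ k n l v w hx) 𝔳 𝔴

theorem thetaIntertwining_rightAct (𝒴 : IntertwiningOperator V W W₂ W₃) (𝔳 : UInf V)
    (𝔴 : UInf W) :
    thetaIntertwining 𝒴 (rightAct V W 𝔴 𝔳) = thetaIntertwining 𝒴 𝔴 ∘ₗ thetaModule V W₂ 𝔳 :=
  matrixOperator_rightDiamond _ _ _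
    (fun _ hμ l _ hx n v => thetaModuleEntry_mem_levelSpace hμ n l v hx)
    (fun _ hμ l _ hx k n v w => thetaIntertwiningEntry_rightEntry 𝒴 hμ k n l v w hx) 𝔴 𝔳

theorem thetaModule_algDiamond (𝔲 𝔳 : UInf V) :
    thetaModule V W (algDiamond V 𝔲 𝔳) = thetaModule V W 𝔲 ∘ₗ thetaModule V W 𝔳 :=
  matrixOperator_leftDiamond _ _ _
    (fun _ hμ l _ hx n w => thetaModuleEntry_mem_levelSpace hμ n l w hx)
    (fun _ hμ l _ hx k n v w => thetaModuleEntry_leftEntry hμ k n l v w hx) 𝔲 𝔳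

theorem thetaModule_oneInf : thetaModule V W (oneInf V) = LinearMap.id := by
  refine linearMap_ext_of_levels (V := V) fun μ hμ l x hx => ?_
  rw [thetaModule_eq, matrixOperator_apply_of_mem _ _ (mem_levelSpace_of_mem_wtSpace hμ rfl hx),
    oneInf, Finsupp.sum_single_index (by simp), thetaModuleEntry_of_mem l l vac_mem_homSpace,
    show (0 : ℤ) + l - l - 1 = -1 by ring]
  exact (LowerBoundedGeneralizedModule.identity (-1) x).trans (if_pos rfl)

end Theta

/-! ### Quotients -/

/-- A bilinear map that is compatible with three submodules induces one on the quotients. -/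
theorem exists_quotient_bilin {M N P : Type*} [AddCommGroup M] [Module ℂ M] [AddCommGroup N]
    [Module ℂ N] [AddCommGroup P] [Module ℂ P] {S : Submodule ℂ M} {T : Submodule ℂ N}
    {R : Submodule ℂ P} (B : M →ₗ[ℂ] N →ₗ[ℂ] P) (h₁ : ∀ x ∈ S, ∀ y, B x y ∈ R)
    (h₂ : ∀ x, ∀ y ∈ T, B x y ∈ R) :
    ∃ C : (M ⧸ S) →ₗ[ℂ] (N ⧸ T) →ₗ[ℂ] (P ⧸ R), ∀ x y,
      C (Submodule.Quotient.mk x) (Submodule.Quotient.mk y) = Submodule.Quotient.mk (B x y) := by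
  refine ⟨S.liftQ (Submodule.mapQLinear T R ∘ₗ
    B.codRestrict (Submodule.compatibleMaps T R) fun x y hy => h₂ x y hy) ?_, fun x y => rfl⟩
  intro x hx
  rw [LinearMap.mem_ker]
  ext y
  exact (Submodule.Quotient.mk_eq_zero R).2 (h₁ x hx y)

section Bimodule

variable {V : Type u} [AddCommGroup V] [Module ℂ V] [GradingRestrictedVertexAlgebra V]
variable {W : Type v} [AddCommGroup W] [Module ℂ W] [LowerBoundedGeneralizedModule V W]

theorem mem_QInfAlg {𝔳 : UInf V} : 𝔳 ∈ QInfAlg.{u, w} V ↔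
    ∀ (W : Type w) [AddCommGroup W] [Module ℂ W] [LowerBoundedGeneralizedModule V W],
      thetaModule V W 𝔳 = 0 := by
  simp only [QInfAlg, Submodule.mem_iInf, LinearMap.mem_ker]

theorem mem_QInfMod {𝔴 : UInf W} : 𝔴 ∈ QInfMod.{u, v, w} V W ↔
    ∀ (W₂ : Type w) [AddCommGroup W₂] [Module ℂ W₂] [LowerBoundedGeneralizedModule V W₂]
      (W₃ : Type w) [AddCommGroup W₃] [Module ℂ W₃] [LowerBoundedGeneralizedModule V W₃]
      (𝒴 : IntertwiningOperator V W W₂ W₃), 𝔴 ∈ LinearMap.ker (thetaIntertwining 𝒴) := by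
  simp only [QInfMod, Submodule.mem_iInf]

variable (V) in
/-- The submodule `S` of `U^∞(W)` is stable under the `⋄`-actions, contains `Q^∞(V) ⋄ U^∞(W)` and
`U^∞(W) ⋄ Q^∞(V)`, and contains the defects of the bimodule identities.  All these conditions say
that certain elements lie in `S`, so they pass to intersections. -/
structure IsDiamondStable (S : Submodule ℂ (UInf W)) : Prop where
  left_mem : ∀ 𝔳 : UInf V, ∀ 𝔴 ∈ S, leftAct V W 𝔳 𝔴 ∈ S
  right_mem : ∀ 𝔳 : UInf V, ∀ 𝔴 ∈ S, rightAct V W 𝔴 𝔳 ∈ S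
  left_Q_mem : ∀ 𝔳 ∈ QInfAlg.{u, w} V, ∀ 𝔴, leftAct V W 𝔳 𝔴 ∈ S
  right_Q_mem : ∀ 𝔳 ∈ QInfAlg.{u, w} V, ∀ 𝔴, rightAct V W 𝔴 𝔳 ∈ S
  one_left : ∀ 𝔴, leftAct V W (oneInf V) 𝔴 - 𝔴 ∈ S
  mul_left : ∀ 𝔲 𝔳 𝔴, leftAct V W (algDiamond V 𝔲 𝔳) 𝔴 - leftAct V W 𝔲 (leftAct V W 𝔳 𝔴) ∈ S
  one_right : ∀ 𝔴, rightAct V W 𝔴 (oneInf V) - 𝔴 ∈ S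
  mul_right : ∀ 𝔲 𝔳 𝔴,
    rightAct V W 𝔴 (algDiamond V 𝔲 𝔳) - rightAct V W (rightAct V W 𝔴 𝔲) 𝔳 ∈ S
  left_right : ∀ 𝔲 𝔳 𝔴,
    rightAct V W (leftAct V W 𝔲 𝔴) 𝔳 - leftAct V W 𝔲 (rightAct V W 𝔴 𝔳) ∈ S

theorem isDiamondStable_ker_thetaIntertwining
    {W₂ : Type w} [AddCommGroup W₂] [Module ℂ W₂] [LowerBoundedGeneralizedModule V W₂]
    {W₃ : Type w} [AddCommGroup W₃] [Module ℂ W₃] [LowerBoundedGeneralizedModule V W₃]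
    (𝒴 : IntertwiningOperator V W W₂ W₃) :
    IsDiamondStable.{u, v, w} V (LinearMap.ker (thetaIntertwining 𝒴)) := by
  constructor <;> intros <;>
    simp_all only [LinearMap.mem_ker, map_sub, thetaIntertwining_leftAct,
      thetaIntertwining_rightAct, thetaModule_algDiamond, thetaModule_oneInf, mem_QInfAlg,
      LinearMap.comp_zero, LinearMap.zero_comp, LinearMap.id_comp, LinearMap.comp_id,
      LinearMap.comp_assoc, sub_self]

theorem isDiamondStable_QInfMod : IsDiamondStable.{u, v, w} V (QInfMod.{u, v, w} V W) := by
  constructor <;> intros <;> refine mem_QInfMod.2 fun W₂ _ _ _ W₃ _ _ _ 𝒴 => ?_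
  · exact (isDiamondStable_ker_thetaIntertwining 𝒴).left_mem _ _ (mem_QInfMod.1 ‹_› W₂ W₃ 𝒴)
  · exact (isDiamondStable_ker_thetaIntertwining 𝒴).right_mem _ _ (mem_QInfMod.1 ‹_› W₂ W₃ 𝒴)
  · exact (isDiamondStable_ker_thetaIntertwining 𝒴).left_Q_mem _ ‹_› _
  · exact (isDiamondStable_ker_thetaIntertwining 𝒴).right_Q_mem _ ‹_› _
  · exact (isDiamondStable_ker_thetaIntertwining 𝒴).one_left _
  · exact (isDiamondStable_ker_thetaIntertwining 𝒴).mul_left _ _ _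
  · exact (isDiamondStable_ker_thetaIntertwining 𝒴).one_right _
  · exact (isDiamondStable_ker_thetaIntertwining 𝒴).mul_right _ _ _
  · exact (isDiamondStable_ker_thetaIntertwining 𝒴).left_right _ _ _

theorem IsDiamondStable.inducesBimodule {S : Submodule ℂ (UInf W)}
    (hS : IsDiamondStable.{u, v, w} V S)
    {mul : AInfAlg.{u, w} V →ₗ[ℂ] AInfAlg.{u, w} V →ₗ[ℂ] AInfAlg.{u, w} V}
    (hmul : ∀ 𝔲 𝔳 : UInf V, mul (Submodule.Quotient.mk 𝔲) (Submodule.Quotient.mk 𝔳) =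
      Submodule.Quotient.mk (algDiamond V 𝔲 𝔳)) : InducesBimodule mul S := by
  obtain ⟨L, hL⟩ := exists_quotient_bilin (S := QInfAlg.{u, w} V) (T := S) (R := S)
    (leftAct V W) hS.left_Q_mem hS.left_mem
  obtain ⟨R, hR⟩ := exists_quotient_bilin (S := S) (T := QInfAlg.{u, w} V) (R := S)
    (rightAct V W) (fun 𝔴 h 𝔳 => hS.right_mem 𝔳 𝔴 h) (fun 𝔴 𝔳 h => hS.right_Q_mem 𝔳 h 𝔴)
  refine ⟨L, R, hL, fun 𝔳 𝔴 => hR 𝔴 𝔳, ?_, ?_, ?_, ?_, ?_⟩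
  · rintro ⟨𝔴⟩
    exact (hL _ _).trans ((Submodule.Quotient.eq S).2 (hS.one_left 𝔴))
  · rintro ⟨𝔲⟩ ⟨𝔳⟩ ⟨𝔴⟩
    change L (mul (Submodule.Quotient.mk 𝔲) (Submodule.Quotient.mk 𝔳)) (Submodule.Quotient.mk 𝔴) =
      L (Submodule.Quotient.mk 𝔲) (L (Submodule.Quotient.mk 𝔳) (Submodule.Quotient.mk 𝔴))
    rw [hmul, hL, hL, hL]
    exact (Submodule.Quotient.eq S).2 (hS.mul_left 𝔲 𝔳 𝔴)
  · rintro ⟨𝔴⟩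
    exact (hR _ _).trans ((Submodule.Quotient.eq S).2 (hS.one_right 𝔴))
  · rintro ⟨𝔴⟩ ⟨𝔲⟩ ⟨𝔳⟩
    change R (Submodule.Quotient.mk 𝔴) (mul (Submodule.Quotient.mk 𝔲) (Submodule.Quotient.mk 𝔳)) =
      R (R (Submodule.Quotient.mk 𝔴) (Submodule.Quotient.mk 𝔲)) (Submodule.Quotient.mk 𝔳)
    rw [hmul, hR, hR, hR]
    exact (Submodule.Quotient.eq S).2 (hS.mul_right 𝔲 𝔳 𝔴)
  · rintro ⟨𝔲⟩ ⟨𝔴⟩ ⟨𝔳⟩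
    change R (L (Submodule.Quotient.mk 𝔲) (Submodule.Quotient.mk 𝔴)) (Submodule.Quotient.mk 𝔳) =
      L (Submodule.Quotient.mk 𝔲) (R (Submodule.Quotient.mk 𝔴) (Submodule.Quotient.mk 𝔳))
    rw [hL, hR, hR, hL]
    exact (Submodule.Quotient.eq S).2 (hS.left_right 𝔲 𝔳 𝔴)

theorem mk_eq_mk_of_thetaModule_eq {𝔲 𝔳 : UInf V}
    (h : ∀ (W : Type w) [AddCommGroup W] [Module ℂ W] [LowerBoundedGeneralizedModule V W],
      thetaModule V W 𝔲 = thetaModule V W 𝔳) :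
    (Submodule.Quotient.mk 𝔲 : AInfAlg.{u, w} V) = Submodule.Quotient.mk 𝔳 := by
  rw [Submodule.Quotient.eq, mem_QInfAlg]
  intro W _ _ _
  rw [map_sub, h W, sub_self]

theorem exists_algMul : ∃ mul : AInfAlg.{u, w} V →ₗ[ℂ] AInfAlg.{u, w} V →ₗ[ℂ] AInfAlg.{u, w} V,
    (∀ 𝔲 𝔳 : UInf V, mul (Submodule.Quotient.mk 𝔲) (Submodule.Quotient.mk 𝔳) =
      Submodule.Quotient.mk (algDiamond V 𝔲 𝔳)) ∧
    IsAssocAlgebra mul (Submodule.Quotient.mk (oneInf V)) := by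
  obtain ⟨mul, hmul⟩ := exists_quotient_bilin (S := QInfAlg.{u, w} V) (T := QInfAlg.{u, w} V)
    (R := QInfAlg.{u, w} V) (algDiamond V)
    (fun 𝔲 h 𝔳 => mem_QInfAlg.2 fun W _ _ _ => by
      rw [thetaModule_algDiamond, mem_QInfAlg.1 h W, LinearMap.zero_comp])
    (fun 𝔲 𝔳 h => mem_QInfAlg.2 fun W _ _ _ => by
      rw [thetaModule_algDiamond, mem_QInfAlg.1 h W, LinearMap.comp_zero])
  refine ⟨mul, hmul, ?_, ?_, ?_⟩
  · rintro ⟨𝔲⟩ ⟨𝔳⟩ ⟨𝔴⟩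
    change mul (mul (Submodule.Quotient.mk 𝔲) (Submodule.Quotient.mk 𝔳)) (Submodule.Quotient.mk 𝔴) =
      mul (Submodule.Quotient.mk 𝔲) (mul (Submodule.Quotient.mk 𝔳) (Submodule.Quotient.mk 𝔴))
    rw [hmul, hmul, hmul, hmul]
    exact mk_eq_mk_of_thetaModule_eq fun W _ _ _ => by
      simp only [thetaModule_algDiamond, LinearMap.comp_assoc]
  · rintro ⟨𝔲⟩
    refine (hmul _ _).trans (mk_eq_mk_of_thetaModule_eq fun W _ _ _ => ?_)
    rw [thetaModule_algDiamond, thetaModule_oneInf, LinearMap.id_comp]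
  · rintro ⟨𝔲⟩
    refine (hmul _ _).trans (mk_eq_mk_of_thetaModule_eq fun W _ _ _ => ?_)
    rw [thetaModule_algDiamond, thetaModule_oneInf, LinearMap.comp_id]

end Bimodule

theorem proposition4p1
    (V : Type u) [AddCommGroup V] [Module ℂ V] [GradingRestrictedVertexAlgebra V]
    (W : Type v) [AddCommGroup W] [Module ℂ W] [LowerBoundedGeneralizedModule V W] :
    -- `ϑ_𝒴` commutes with the left and right actions of `U^∞(V)`
    (∀ (W₂ : Type w) [AddCommGroup W₂] [Module ℂ W₂] [LowerBoundedGeneralizedModule V W₂]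
      (W₃ : Type w) [AddCommGroup W₃] [Module ℂ W₃] [LowerBoundedGeneralizedModule V W₃]
      (𝒴 : IntertwiningOperator V W W₂ W₃) (𝔳 : UInf V) (𝔴 : UInf W),
      thetaIntertwining 𝒴 (leftAct V W 𝔳 𝔴) =
          thetaModule V W₃ 𝔳 ∘ₗ thetaIntertwining 𝒴 𝔴 ∧
      thetaIntertwining 𝒴 (rightAct V W 𝔴 𝔳) =
          thetaIntertwining 𝒴 𝔴 ∘ₗ thetaModule V W₂ 𝔳) ∧
    -- `⋄` makes `A^∞(V)` an associative algebra, and the quotients are bimodules for it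
    ∃ mul : AInfAlg.{u, w} V →ₗ[ℂ] AInfAlg.{u, w} V →ₗ[ℂ] AInfAlg.{u, w} V,
      (∀ 𝔲 𝔳 : UInf V, mul (Submodule.Quotient.mk 𝔲) (Submodule.Quotient.mk 𝔳) =
        Submodule.Quotient.mk (algDiamond V 𝔲 𝔳)) ∧
      IsAssocAlgebra mul (Submodule.Quotient.mk (oneInf V)) ∧
      (∀ (W₂ : Type w) [AddCommGroup W₂] [Module ℂ W₂] [LowerBoundedGeneralizedModule V W₂]
        (W₃ : Type w) [AddCommGroup W₃] [Module ℂ W₃] [LowerBoundedGeneralizedModule V W₃]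
        (𝒴 : IntertwiningOperator V W W₂ W₃),
        InducesBimodule mul (LinearMap.ker (thetaIntertwining 𝒴))) ∧
      InducesBimodule mul (QInfMod.{u, v, w} V W) := by
  refine ⟨fun W₂ _ _ _ W₃ _ _ _ 𝒴 𝔳 𝔴 =>
    ⟨thetaIntertwining_leftAct 𝒴 𝔳 𝔴, thetaIntertwining_rightAct 𝒴 𝔳 𝔴⟩, ?_⟩
  obtain ⟨mul, hmul, hassoc⟩ := exists_algMul (V := V)
  exact ⟨mul, hmul, hassoc,
    fun W₂ _ _ _ W₃ _ _ _ 𝒴 => (isDiamondStable_ker_thetaIntertwining 𝒴).inducesBimodule hmul,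
    isDiamondStable_QInfMod.inducesBimodule hmul⟩
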